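/- Let $G$ be a Lie group, $\pi\colon P\to M$ a smooth principal $G$-bundle over an $n$-dimensional manifold $M$ with a volume form $\mathbf v$, and $p\colon C\to M$ the bundle of connections of $P$: a point of $C$ over $x$ is a linear section $T_xM\to (TP/G)_x$ of the map $\pi_*\colon (TP/G)_x\to T_xM$, and $C$ has the coordinates $(x^i,A^\alpha_j)$ defined by writing the horizontal lift of $\partial/\partial x^j$ at $(x,1)$, in a local trivialisation $\pi^{-1}(U)\cong U\times G$, as $\partial/\partial x^j-A_j^\alpha B_\alpha$, with $(B_\alpha)$ a basis of the Lie algebra of $G$. Let $\mathrm{Gau}\,P$ be the group of $G$-equivariant diffeomorphisms of $P$ over $\mathrm{id}_M$. Each $\Phi\in\mathrm{Gau}\,P$ acts on connections by sending the horizontal subspace $H_u$ to $\Phi_*H_u$ at $\Phi(u)$; this defines a diffeomorphism $\Phi_C\colon C\to C$ over $\mathrm{id}_M$ and its prolongation $\Phi_C^{(1)}\colon J^1C\to J^1C$, $\Phi_C^{(1)}(j^1_xs)=j^1_x(\Phi_C\circ s)$. Let $L\colon J^1C\to\mathbb R$ be a smooth gauge-invariant function, i.e. $L\circ\Phi_C^{(1)}=L$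 for all $\Phi\in\mathrm{Gau}\,P$, and let $\Lambda=L\mathbf v$. In fibred coordinates $(x^i,y^\alpha)$ of $p$, with induced coordinates $(x^i,y^\alpha,y^\alpha_i)$ on $J^1C$, write $\Lambda=\ell\,dx^1\wedge\dots\wedge dx^n$ and let $$\Theta_\Lambda=\frac{\partial \ell}{\partial y^\alpha_i}\,(dy^\alpha-y^\alpha_j dx^j)\wedge i_{\partial/\partial x^i}(dx^1\wedge\dots\wedge dx^n)+\ell\,dx^1\wedge\dots\wedge dx^n$$ be the Poincaré–Cartan form. Let $\bar{\mathcal S}_\Lambda$ be the set of solutions of the Hamilton–Cartan equations: the smooth sections $\bar s$ of $J^1C\to M$ such that $\bar s^*(i_Xd\Theta_\Lambda)=0$ for all vector fields $X$ on $J^1C$ that are vertical over $M$. Let $\mathcal S_\Lambda$ be the set of solutions of the Euler–Lagrange equations: the smooth sections $s$ of $p$ such that $$\frac{\partial \ell}{\partial y^\alpha}\circ j^1s-\frac{\partial}{\partial x^j}\Bigl(\frac{\partial \ell}{\partial y^\alpha_j}\circ j^1s\Bigr)=0$$ for all $\alpha$, in all fibred coordinates. Then for every $\Phi\in\mathrm{Gau}\,P$: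 if $\bar s\in\bar{\mathcal S}_\Lambda$, then $\Phi_C^{(1)}\circ\bar s\in\bar{\mathcal S}_\Lambda$; and if $s\in\mathcal S_\Lambda$, then $\Phi_C\circ s\in\mathcal S_\Lambda$. Accordingly, $\mathrm{Gau}\,P$ acts on the left on $\bar{\mathcal S}_\Lambda$ by $\Phi\cdot\bar s=\Phi_C^{(1)}\circ\bar s$ and on $\mathcal S_\Lambda$ by $\Phi\cdot s=\Phi_C\circ s$. -/

import Mathlib

open scoped Manifold ContDiff Topology

set_option linter.unusedSectionVars false

noncomputable section

/-- The coordinate space `ℝⁿ`. -/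
abbrev Coord (n : ℕ) := EuclideanSpace ℝ (Fin n)

/-! ### Tangent maps -/

section tmap
variable {E E' E'' H H' H'' N N' N'' : Type*}
  [NormedAddCommGroup E] [NormedSpace ℝ E] [TopologicalSpace H]
  [TopologicalSpace N] [ChartedSpace H N]
  [NormedAddCommGroup E'] [NormedSpace ℝ E'] [TopologicalSpace H']
  [TopologicalSpace N'] [ChartedSpace H' N']
  [NormedAddCommGroup E''] [NormedSpace ℝ E''] [TopologicalSpace H'']
  [TopologicalSpace N''] [ChartedSpace H'' N'']
  (I : ModelWithCorners ℝ E H) (I' : ModelWithCorners ℝ E' H') (I'' : ModelWithCorners ℝ E'' H'')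

/-- The tangent map `T_x f : T_x N → T_{f x} N'` (Mathlib's `mfderiv`). In Mathlib the tangent space
of a manifold at any point is, by definition, the model vector space; this is used to give `tmap`
a non-dependent type. -/
def tmap (f : N → N') (x : N) : E →L[ℝ] E' := mfderiv I I' f x

variable {I I' I''}

theorem tmap_comp {f : N → N'} {g : N' → N''} (x : N) (hg : MDifferentiableAt I' I'' g (f x))
    (hf : MDifferentiableAt I I' f x) :
    tmap I I'' (fun z => g (f z)) x = tmap I' I'' g (f x) ∘L tmap I I' f x :=
  mfderiv_comp x hg hf

theorem tmap_comp_of_eq {f : N → N'} {g : N' → N''} (x : N) {y : N'} (h : f x = y)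
    (hg : MDifferentiableAt I' I'' g y)
    (hf : MDifferentiableAt I I' f x) :
    tmap I I'' (fun z => g (f z)) x = tmap I' I'' g y ∘L tmap I I' f x := by
  subst h; exact mfderiv_comp x hg hf

theorem tmap_congr {f g : N → N'} {x : N} (h : f =ᶠ[𝓝 x] g) : tmap I I' f x = tmap I I' g x := by
  unfold tmap
  rw [h.mfderiv_eq]

theorem tmap_id (x : N) : tmap I I (fun z : N => z) x = ContinuousLinearMap.id ℝ E := mfderiv_id

theorem tmap_const (x : N) (c : N') : tmap I I' (fun _ : N => c) x = 0 := mfderiv_const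

theorem tmap_comp₂ {f : N → N'} {g : N → N''} {E₃ H₃ N₃ : Type*} [NormedAddCommGroup E₃] [NormedSpace ℝ E₃]
    [TopologicalSpace H₃] [TopologicalSpace N₃] [ChartedSpace H₃ N₃] {I₃ : ModelWithCorners ℝ E₃ H₃}
    (F : N' × N'' → N₃) (x : N) {y : N'} {z : N''} (hy : f x = y) (hz : g x = z)
    (hF : MDifferentiableAt (I'.prod I'') I₃ F (y, z))
    (hf : MDifferentiableAt I I' f x) (hg : MDifferentiableAt I I'' g x) :
    tmap I I₃ (fun w => F (f w, g w)) x =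
      tmap I' I₃ (fun a => F (a, z)) y ∘L tmap I I' f x
        + tmap I'' I₃ (fun b => F (y, b)) z ∘L tmap I I'' g x := by
  subst hy hz
  have h1 := tmap_comp (I := I) (I' := I'.prod I'') (I'' := I₃) (f := fun w => (f w, g w)) (g := F) x hF (hf.prodMk hg)
  rw [h1]
  have h2 : tmap I (I'.prod I'') (fun w => (f w, g w)) x = (tmap I I' f x).prod (tmap I I'' g x) :=
    mfderiv_prodMk hf hg
  have h3 : tmap (I'.prod I'') I₃ F (f x, g x) =
      tmap I' I₃ (fun a => F (a, g x)) (f x) ∘L ContinuousLinearMap.fst ℝ E' E''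
      + tmap I'' I₃ (fun b => F (f x, b)) (g x) ∘L ContinuousLinearMap.snd ℝ E' E'' :=
    mfderiv_prod_eq_add_comp hF
  rw [h2, h3]
  ext v
  simp

end tmap

section
variable {n m : ℕ} 
  {G : Type*} [TopologicalSpace G] [ChartedSpace (Coord m) G] [IsManifold (𝓡 m) ∞ G]

theorem contDiffAt_tmap_self (a : G) (f : Coord n → Coord n → G) (y₀ : Coord n)
    (hf : ContMDiffAt ((𝓡 n).prod (𝓡 n)) (𝓡 m) ∞ (Function.uncurry f) (y₀, y₀))
    (h : ∀ᶠ y in 𝓝 y₀, f y y = a) :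
    ContDiffAt ℝ ∞ (fun y => tmap (𝓡 n) (𝓡 m) (f y) y) y₀ := by
  have h1 : IsManifold (𝓡 m) 1 G := IsManifold.of_le (n := ∞) (by simp)
  have h2 : ContMDiffAt (𝓡 n) 𝓘(ℝ, Coord n →L[ℝ] Coord m) ∞ (inTangentCoordinates (𝓡 n) (𝓡 m) (fun y => y)
      (fun y => f y y) (fun y => tmap (𝓡 n) (𝓡 m) (f y) y) y₀) y₀ :=
    ContMDiffAt.mfderiv (m := ∞) (n := ∞) f (fun y => y) hf contMDiffAt_id (by simp)
  rw [← contMDiffAt_iff_contDiffAt]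
  refine h2.congr_of_eventuallyEq ?_
  filter_upwards [h] with y hy
  have h0 := h.self_of_nhds
  have hs : f y y ∈ (chartAt (Coord m) (f y₀ y₀)).source := by
    rw [hy, h0]; exact mem_chart_source _ _
  refine Eq.trans ?_ (inTangentCoordinates_eq (I := 𝓡 n) (I' := 𝓡 m) (fun y => y)
    (fun y => f y y) (fun y => tmap (𝓡 n) (𝓡 m) (f y) y) (x₀ := y₀) (x := y)
    (Set.mem_univ y) hs).symm
  ext1 v
  simp only [hy, h0]
  simp only [ContinuousLinearMap.comp_apply]
  rw [(tangentBundleCore (𝓡 m) G).coordChange_self _ _ (mem_chart_source _ _)]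
  rw [tangentBundleCore_coordChange_model_space]
  rfl

theorem contDiffAt_tmap_const {N : Type*} [NormedAddCommGroup N] [NormedSpace ℝ N] (a : G) (f : N → G → G) (y₀ : N)
    (hf : ContMDiffAt ((𝓘(ℝ, N)).prod (𝓡 m)) (𝓡 m) ∞ (Function.uncurry f) (y₀, a))
    (h : ∀ᶠ y in 𝓝 y₀, f y a = a) :
    ContDiffAt ℝ ∞ (fun y => tmap (𝓡 m) (𝓡 m) (f y) a) y₀ := by
  have h1 : IsManifold (𝓡 m) 1 G := IsManifold.of_le (n := ∞) (by simp)
  have h2 : ContMDiffAt 𝓘(ℝ, N) 𝓘(ℝ, Coord m →L[ℝ] Coord m) ∞ (inTangentCoordinates (𝓡 m) (𝓡 m) (fun _ => a)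
      (fun y => f y a) (fun y => tmap (𝓡 m) (𝓡 m) (f y) a) y₀) y₀ :=
    ContMDiffAt.mfderiv (m := ∞) (n := ∞) f (fun _ => a) hf contMDiffAt_const (by simp)
  rw [← contMDiffAt_iff_contDiffAt]
  refine h2.congr_of_eventuallyEq ?_
  filter_upwards [h] with y hy
  have h0 := h.self_of_nhds
  have hs : f y a ∈ (chartAt (Coord m) (f y₀ a)).source := by
    rw [hy, h0]; exact mem_chart_source _ _
  refine Eq.trans ?_ (inTangentCoordinates_eq (I := 𝓡 m) (I' := 𝓡 m) (fun _ : N => a)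
    (fun y => f y a) (fun y => tmap (𝓡 m) (𝓡 m) (f y) a) (x₀ := y₀) (x := y)
    (mem_chart_source _ _) hs).symm
  ext1 v
  simp only [hy, h0]
  simp only [ContinuousLinearMap.comp_apply]
  rw [(tangentBundleCore (𝓡 m) G).coordChange_self _ _ (mem_chart_source _ _)]
  rw [(tangentBundleCore (𝓡 m) G).coordChange_self _ _ (mem_chart_source _ _)]
end


/-! ### Fibred manifolds, first jets, Hamilton-Cartan and Euler-Lagrange equations -/

section Fibred

/-- The standard volume form `dx¹ ∧ … ∧ dxⁿ` of `ℝⁿ`. -/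
def stdVolume (n : ℕ) : Coord n [⋀^Fin n]→L[ℝ] ℝ :=
  { toMultilinearMap := (EuclideanSpace.basisFun (Fin n) ℝ).toBasis.det.toMultilinearMap
    map_eq_zero_of_eq' := (EuclideanSpace.basisFun (Fin n) ℝ).toBasis.det.map_eq_zero_of_eq'
    cont := by
      change Continuous fun v => (EuclideanSpace.basisFun (Fin n) ℝ).toBasis.det v
      simp only [Module.Basis.det_apply]
      refine Continuous.matrix_det ?_
      refine continuous_pi fun i => continuous_pi fun j => ?_
      simp only [Module.Basis.toMatrix_apply, OrthonormalBasis.coe_toBasis_repr_apply,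
        EuclideanSpace.basisFun_repr]
      fun_prop }

/-- The `n`-form `(w₁, …, wₙ) ↦ ∑ₖ ν(f w₁, …, g wₖ, …, f wₙ)` on `V`, the `k`-th argument of `ν` in
the `k`-th term being `g wₖ` and all other ones `f wₗ`. If `g w = ∑ᵢ aᵢ(w) eᵢ` with one-forms `aᵢ`
on `V` and vectors `eᵢ` of `W`, this is `∑ᵢ aᵢ ∧ f^*(i_{eᵢ} ν)`. -/
def replaceEach {n : ℕ} {V W : Type*} [NormedAddCommGroup V] [NormedSpace ℝ V]
    [NormedAddCommGroup W] [NormedSpace ℝ W]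
    (ν : W [⋀^Fin n]→L[ℝ] ℝ) (f g : V →L[ℝ] W) : V [⋀^Fin n]→L[ℝ] ℝ :=
  { toContinuousMultilinearMap := ∑ k : Fin n,
      ν.toContinuousMultilinearMap.compContinuousLinearMap fun i => if i = k then g else f
    map_eq_zero_of_eq' := by
      intro v i j hv hij
      change (∑ k : Fin n, ν.toContinuousMultilinearMap.compContinuousLinearMap
        fun i => if i = k then g else f) v = 0
      rw [sum_apply]
      rw [Finset.sum_eq_add i j hij]
      · have : (fun l => (if l = j then g else f) (v l))
            = (fun l => (if l = i then g else f) (v l)) ∘ Equiv.swap i j := by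
          funext l
          by_cases h1 : l = i
          · subst h1; simp [hij, hij.symm, hv]
          by_cases h2 : l = j
          · subst h2; simp [hv]
          simp [h1, h2, Equiv.swap_apply_of_ne_of_ne]
        change ν (fun l => (if l = i then g else f) (v l))
          + ν (fun l => (if l = j then g else f) (v l)) = 0
        rw [this]
        have h := ν.toAlternatingMap.map_swap (fun l => (if l = i then g else f) (v l)) hij
        change ν _ = - ν _ at h
        rw [h, add_neg_cancel]
      · intro c _ hc
        change ν (fun l => (if l = c then g else f) (v l)) = 0
        refine ν.map_eq_zero_of_eq _ ?_ hij
        simp [hc.1.symm, hc.2.symm, hv]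
      · simp
      · simp }


/-- The `i`-th vector `∂/∂xⁱ` of the standard frame of `ℝⁿ`. -/
def stdVec {n : ℕ} (i : Fin n) : Coord n := EuclideanSpace.single i 1

/-- The space of values `(xⁱ, y^α, y_i^α)` of the coordinates on a first jet bundle. The fibre
coordinates `y^α` are collected in a vector of `F` and the `y_i^α` in a linear map `ℝⁿ → F`
(`y_i` is the image of the `i`-th basis vector). -/
abbrev JetCoord (n : ℕ) (F : Type*) [NormedAddCommGroup F] [NormedSpace ℝ F] : Type _ :=
  Coord n × F × (Coord n →L[ℝ] F)

section LocalCalculus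

variable {n : ℕ} {F : Type*} [NormedAddCommGroup F] [NormedSpace ℝ F]

/-- The partial derivative `∂ℓ/∂y_i` (a covector on `F`, with components `∂ℓ/∂y_i^α`). -/
def partialJet (ℓ : JetCoord n F → ℝ) (q : JetCoord n F) (i : Fin n) : F →L[ℝ] ℝ :=
  fderiv ℝ ℓ q ∘L ContinuousLinearMap.inr ℝ (Coord n) (F × (Coord n →L[ℝ] F)) ∘L
    ContinuousLinearMap.inr ℝ F (Coord n →L[ℝ] F) ∘L
    ContinuousLinearMap.smulRightL ℝ (Coord n) F (EuclideanSpace.proj i)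

/-- The partial derivative `∂ℓ/∂y` (a covector on `F`, with components `∂ℓ/∂y^α`). -/
def partialFibre (ℓ : JetCoord n F → ℝ) (q : JetCoord n F) : F →L[ℝ] ℝ :=
  fderiv ℝ ℓ q ∘L ContinuousLinearMap.inr ℝ (Coord n) (F × (Coord n →L[ℝ] F)) ∘L
    ContinuousLinearMap.inl ℝ F (Coord n →L[ℝ] F)

/-- The (`F`-valued) contact form `θ = dy - y_i dxⁱ`. -/
def contactForm (q : JetCoord n F) : JetCoord n F →L[ℝ] F :=
  ContinuousLinearMap.fst ℝ F (Coord n →L[ℝ] F) ∘L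
      ContinuousLinearMap.snd ℝ (Coord n) (F × (Coord n →L[ℝ] F)) -
    q.2.2 ∘L ContinuousLinearMap.fst ℝ (Coord n) (F × (Coord n →L[ℝ] F))

/-- The Poincaré-Cartan form
`Θ = (∂ℓ/∂y_i^α) θ^α ∧ i_{∂/∂xⁱ}(dx¹ ∧ … ∧ dxⁿ) + ℓ dx¹ ∧ … ∧ dxⁿ`
of the Lagrangian density `ℓ dx¹ ∧ … ∧ dxⁿ`. -/
def poincareCartan (ℓ : JetCoord n F → ℝ) (q : JetCoord n F) : JetCoord n F [⋀^Fin n]→L[ℝ] ℝ :=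
  replaceEach (stdVolume n) (ContinuousLinearMap.fst ℝ (Coord n) (F × (Coord n →L[ℝ] F)))
      (∑ i, (partialJet ℓ q i ∘L contactForm q).smulRight (stdVec i)) +
    ℓ q • (stdVolume n).compContinuousLinearMap
      (ContinuousLinearMap.fst ℝ (Coord n) (F × (Coord n →L[ℝ] F)))

/-- The Euler-Lagrange expression
`∂ℓ/∂y (j¹s) - ∂/∂xʲ (∂ℓ/∂y_j ∘ j¹s)` at `y`, paired with `w`, of the Lagrangian density
`ℓ dx¹ ∧ … ∧ dxⁿ`. -/
def eulerLagrange (ℓ : JetCoord n F → ℝ) (s : Coord n → F) (y : Coord n) (w : F) : ℝ :=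
  partialFibre ℓ (y, s y, fderiv ℝ s y) w -
    ∑ j, fderiv ℝ (fun z => partialJet ℓ (z, s z, fderiv ℝ s z) j w) y (stdVec j)

end LocalCalculus

/-- A volume form on an `n`-dimensional manifold `M`: a smooth, nowhere vanishing `n`-form. -/
structure VolumeForm (n : ℕ) (M : Type*) [TopologicalSpace M] [ChartedSpace (Coord n) M] where
  /-- the value at `x`, an alternating form on the tangent space at `x` -/
  form : (x : M) → TangentSpace (𝓡 n) x [⋀^Fin n]→L[ℝ] ℝ
  smooth : ∀ φ ∈ IsManifold.maximalAtlas (𝓡 n) ∞ M, ContDiffOn ℝ ∞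
    (fun y : Coord n => form (φ.symm y) fun i => tmap (𝓡 n) (𝓡 n) φ.symm y (stdVec i)) φ.target
  ne_zero : ∀ x, form x ≠ 0

/-- The coefficient `ρ` of a volume form `ρ dx¹ ∧ … ∧ dxⁿ` in a chart of `M`. -/
def VolumeForm.coeff {n : ℕ} {M : Type*} [TopologicalSpace M] [ChartedSpace (Coord n) M]
    (v : VolumeForm n M) (φ : OpenPartialHomeomorph M (Coord n)) (y : Coord n) : ℝ :=
  v.form (φ.symm y) fun i => tmap (𝓡 n) (𝓡 n) φ.symm y (stdVec i)

variable (n : ℕ) {M : Type*} [TopologicalSpace M] [ChartedSpace (Coord n) M]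
  (F : Type*) [NormedAddCommGroup F] [NormedSpace ℝ F]
  {Y : Type*} [TopologicalSpace Y] [ChartedSpace (Coord n × F) Y]

/-- A fibred coordinate system `(xⁱ, y^α)` of `p : Y → M`: a chart of `Y` whose first component is
a chart of `M`. -/
structure FibredChart (p : Y → M) where
  /-- the chart `(xⁱ)` of the base -/
  base : OpenPartialHomeomorph M (Coord n)
  base_mem : base ∈ IsManifold.maximalAtlas (𝓡 n) ∞ M
  /-- the chart `(xⁱ, y^α)` of the total space -/
  total : OpenPartialHomeomorph Y (Coord n × F)
  total_mem : total ∈ IsManifold.maximalAtlas 𝓘(ℝ, Coord n × F) ∞ Y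
  proj_mem : ∀ e ∈ total.source, p e ∈ base.source
  fst_eq : ∀ e ∈ total.source, (total e).1 = base (p e)

/-- A point of the first jet bundle `J¹Y` of `p : Y → M`: the jet `j_x¹ s` of a section is identified
with the point `s x` of `Y` and the tangent map `s_* : T_x M → T_{s x} Y`, an arbitrary linear
section of the tangent map of `p`. -/
@[ext]
structure FirstJet (p : Y → M) where
  /-- the image under `J¹Y → Y` -/
  pt : Y
  /-- the linear map `T_x M → T_{pt} Y`, where `x = p pt` -/
  lin : Coord n →L[ℝ] Coord n × F
  proj_lin : tmap 𝓘(ℝ, Coord n × F) (𝓡 n) p pt ∘L lin = ContinuousLinearMap.id ℝ (Coord n)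

/-- A smooth map `Y → Y` over the identity of `M`. -/
structure FibredMap (p : Y → M) where
  /-- the map -/
  toFun : Y → Y
  smooth : ContMDiff 𝓘(ℝ, Coord n × F) 𝓘(ℝ, Coord n × F) ∞ toFun
  proj_toFun : ∀ e, p (toFun e) = p e

variable {n F}

/-- The map `Φ⁽¹⁾ : J¹Y → J¹Y`, `Φ⁽¹⁾(j_x¹ s) = j_x¹(Φ ∘ s)`, induced by a fibred map `Φ` over the
identity. -/
def FibredMap.prolong {p : Y → M} (Φ : FibredMap n F p)
    (hp : ContMDiff 𝓘(ℝ, Coord n × F) (𝓡 n) ∞ p) (j : FirstJet n F p) : FirstJet n F p where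
  pt := Φ.toFun j.pt
  lin := tmap 𝓘(ℝ, Coord n × F) 𝓘(ℝ, Coord n × F) Φ.toFun j.pt ∘L j.lin
  proj_lin := by
    have h := tmap_comp (I := 𝓘(ℝ, Coord n × F)) j.pt
      (hp.mdifferentiable (by simp) (Φ.toFun j.pt)) (Φ.smooth.mdifferentiable (by simp) j.pt)
    simp only [Φ.proj_toFun] at h
    rw [← ContinuousLinearMap.comp_assoc, ← h, j.proj_lin]

namespace FibredChart

variable {p : Y → M} (c : FibredChart n F p)

/-- The coordinates `(xⁱ, y^α, y_i^α)` on `J¹Y` induced by a fibred coordinate system;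
`y_i^α(j_x¹ s) = ∂(y^α ∘ s)/∂xⁱ (x)` is the `y^α`-component of the image of `∂/∂xⁱ` under `s_*`. -/
def jetCoord (j : FirstJet n F p) : JetCoord n F :=
  (c.base (p j.pt), (c.total j.pt).2,
    ContinuousLinearMap.snd ℝ (Coord n) F ∘L
      tmap 𝓘(ℝ, Coord n × F) 𝓘(ℝ, Coord n × F) c.total j.pt ∘L j.lin ∘L
        tmap (𝓡 n) (𝓡 n) c.base.symm (c.base (p j.pt)))

/-- The range of the induced coordinates on `J¹Y`. -/
def jetRange : Set (JetCoord n F) := {q | (q.1, q.2.1) ∈ c.total.target}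

/-- The expression of a function on `J¹Y` in the induced coordinates. -/
def localFun (L : FirstJet n F p → ℝ) : JetCoord n F → ℝ :=
  Function.extend (fun j : {j : FirstJet n F p // j.pt ∈ c.total.source} => c.jetCoord j)
    (fun j => L j) 0

/-- The coefficient `ℓ` of the Lagrangian density `Λ = L v = ℓ dx¹ ∧ … ∧ dxⁿ` in a fibred coordinate
system. In coordinates adapted to `v`, that is `v = dx¹ ∧ … ∧ dxⁿ`, it is the expression of `L`. -/
def density (v : VolumeForm n M) (L : FirstJet n F p → ℝ) (q : JetCoord n F) : ℝ :=
  c.localFun L q * v.coeff c.base q.1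

/-- The points of the chart of the base over which a section of `Y` lies in the chart of `Y`. -/
def secDomain (s : M → Y) : Set (Coord n) :=
  {y | y ∈ c.base.target ∧ s (c.base.symm y) ∈ c.total.source}

/-- The fibre components `y^α ∘ s` of a section, as functions of `xⁱ`. -/
def localSec (s : M → Y) (y : Coord n) : F := (c.total (s (c.base.symm y))).2

/-- The expression of a section of `J¹Y → M` in coordinates. -/
def localJetSec (s : M → FirstJet n F p) (y : Coord n) : JetCoord n F :=
  c.jetCoord (s (c.base.symm y))

end FibredChart

/-- Smoothness of a function on `J¹Y`. -/
def IsSmoothLagrangian {p : Y → M} (L : FirstJet n F p → ℝ) : Prop :=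
  ∀ c : FibredChart n F p, ContDiffOn ℝ ∞ (c.localFun L) c.jetRange

/-- Smooth sections of `p : Y → M`. -/
def IsSmoothSection (p : Y → M) (s : M → Y) : Prop :=
  (∀ x, p (s x) = x) ∧ ContMDiff (𝓡 n) 𝓘(ℝ, Coord n × F) ∞ s

/-- Smooth sections of `p₁ : J¹Y → M`. -/
def IsSmoothJetSection {p : Y → M} (s : M → FirstJet n F p) : Prop :=
  IsSmoothSection (n := n) (F := F) p (fun x => (s x).pt) ∧
    ∀ c : FibredChart n F p,
      ContDiffOn ℝ ∞ (c.localJetSec s) (c.secDomain fun x => (s x).pt)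

/-- The solutions of the Hamilton-Cartan equations of `Λ = L v`: the smooth sections `s̄` of
`J¹Y → M` with `s̄^*(i_X dΘ_Λ) = 0` for all vector fields `X` on `J¹Y` vertical over `M`, written in
all fibred coordinate systems. -/
def hamiltonCartanSolutions {p : Y → M} (v : VolumeForm n M) (L : FirstJet n F p → ℝ) :
    Set (M → FirstJet n F p) :=
  {s | IsSmoothJetSection s ∧ ∀ c : FibredChart n F p,
    ∀ X : JetCoord n F → F × (Coord n →L[ℝ] F), ContDiffOn ℝ ∞ X c.jetRange →
    ∀ y ∈ c.secDomain fun x => (s x).pt, ∀ w : Fin n → Coord n,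
      extDeriv (poincareCartan (c.density v L)) (c.localJetSec s y)
        (Fin.cons (0, X (c.localJetSec s y)) fun i => fderiv ℝ (c.localJetSec s) y (w i)) = 0}

/-- The solutions of the Euler-Lagrange equations of `Λ = L v`: the smooth sections of `Y → M` on
which the Euler-Lagrange operator vanishes, written in all fibred coordinate systems. -/
def eulerLagrangeSolutions {p : Y → M} (v : VolumeForm n M) (L : FirstJet n F p → ℝ) :
    Set (M → Y) :=
  {s | IsSmoothSection (n := n) (F := F) p s ∧ ∀ c : FibredChart n F p, ∀ y ∈ c.secDomain s,
    ∀ w : F, eulerLagrange (c.density v L) (c.localSec s) y w = 0}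

end Fibred

/-! ### Principal bundles and the bundle of connections -/

section PrincipalBundle

variable {n m k : ℕ} {M : Type*} [TopologicalSpace M] [ChartedSpace (Coord n) M]
  {G : Type*} [TopologicalSpace G] [ChartedSpace (Coord m) G] [Group G]
  {P : Type*} [TopologicalSpace P] [ChartedSpace (Coord k) P]

/-- Smooth, equivariant local trivialisations `π⁻¹(U) ≅ U × G` of a principal bundle. -/
structure IsPrincipalTriv (act : P → G → P) {proj : P → M}
    (e : Bundle.Trivialization G proj) : Prop where
  contMDiffOn : ContMDiffOn (𝓡 k) ((𝓡 n).prod (𝓡 m)) ∞ e e.source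
  contMDiffOn_symm : ContMDiffOn ((𝓡 n).prod (𝓡 m)) (𝓡 k) ∞
    e.toOpenPartialHomeomorph.symm e.target
  equivariant : ∀ u ∈ e.source, ∀ g, (e (act u g)).2 = (e u).2 * g

variable (n m k M G P) in
/-- A principal `G`-bundle `π : P → M` with right action `act`: it is smoothly and equivariantly
locally isomorphic to `U × G → U`, where `G` acts on `U × G` by right translations. -/
structure PrincipalBundle where
  /-- the projection `π` -/
  proj : P → M
  /-- the right action `(u, g) ↦ u · g` -/
  act : P → G → P
  act_one : ∀ u, act u 1 = u
  act_mul : ∀ u g h, act u (g * h) = act (act u g) h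
  proj_act : ∀ u g, proj (act u g) = proj u
  contMDiff_proj : ContMDiff (𝓡 k) (𝓡 n) ∞ proj
  contMDiff_act : ContMDiff ((𝓡 k).prod (𝓡 m)) (𝓡 k) ∞ fun q : P × G => act q.1 q.2
  locally_trivial : ∀ x, ∃ e : Bundle.Trivialization G proj, x ∈ e.baseSet ∧
    IsPrincipalTriv (n := n) (m := m) (k := k) act e

namespace PrincipalBundle

variable (𝔓 : PrincipalBundle n m k M G P)

/-- The gauge group `Gau P`: the equivariant diffeomorphisms of `P` over the identity of `M`, under
composition. -/
def gauge : Subgroup (Equiv.Perm P) where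
  carrier := {Φ | ContMDiff (𝓡 k) (𝓡 k) ∞ Φ ∧ ContMDiff (𝓡 k) (𝓡 k) ∞ Φ.symm ∧
    (∀ u g, Φ (𝔓.act u g) = 𝔓.act (Φ u) g) ∧ ∀ u, 𝔓.proj (Φ u) = 𝔓.proj u}
  mul_mem' := by
    rintro Φ Ψ ⟨h1, h2, h3, h4⟩ ⟨h1', h2', h3', h4'⟩
    exact ⟨h1.comp h1', h2'.comp h2, fun u g => by simp [h3, h3'], fun u => by simp [h4, h4']⟩
  one_mem' := ⟨contMDiff_id, contMDiff_id, fun _ _ => rfl, fun _ => rfl⟩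
  inv_mem' := by
    rintro Φ ⟨h1, h2, h3, h4⟩
    refine ⟨h2, h1, fun u g => ?_, fun u => ?_⟩
    · apply Φ.injective
      simp [h3]
    · have := h4 (Φ⁻¹ u)
      simpa using this.symm

/-- A point of the bundle of connections `C(P)` over `x = base`: a connection at `x`, that is, a linear
section `T_x M → (TP/G)_x` of the map `(TP/G)_x → T_x M` induced by `π`. An element of `(TP/G)_x` is a
`G`-invariant family of tangent vectors of `P` along the fibre of `x`, so such a section is a family
of horizontal lifts `T_x M → T_u P`, `π u = x`, invariant under `G`. (For `u` outside the fibre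
the value is `0` by convention.) -/
@[ext]
structure Conn where
  /-- the point `x` of `M` -/
  base : M
  /-- the horizontal lift `T_x M → T_u P` -/
  lift : P → Coord n →L[ℝ] Coord k
  proj_lift : ∀ u, 𝔓.proj u = base →
    tmap (𝓡 k) (𝓡 n) 𝔓.proj u ∘L lift u = ContinuousLinearMap.id ℝ (Coord n)
  lift_act : ∀ u, 𝔓.proj u = base → ∀ g,
    lift (𝔓.act u g) = tmap (𝓡 k) (𝓡 k) (fun w => 𝔓.act w g) u ∘L lift u
  lift_off : ∀ u, 𝔓.proj u ≠ base → lift u = 0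

theorem Conn.ext_lift {𝔓 : PrincipalBundle n m k M G P} {c d : 𝔓.Conn} (h : c.base = d.base)
    (h' : ∀ u, 𝔓.proj u = c.base → c.lift u = d.lift u) : c = d := by
  refine Conn.ext h (funext fun u => ?_)
  by_cases hu : 𝔓.proj u = c.base
  · exact h' u hu
  · rw [c.lift_off u hu, d.lift_off u (h ▸ hu)]

/-- A chart of `M` and a local trivialisation of `P`. -/
structure LocalCoords where
  /-- the chart -/
  chart : OpenPartialHomeomorph M (Coord n)
  chart_mem : chart ∈ IsManifold.maximalAtlas (𝓡 n) ∞ M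
  /-- the local trivialisation -/
  triv : Bundle.Trivialization G 𝔓.proj
  triv_mem : IsPrincipalTriv (n := n) (m := m) (k := k) 𝔓.act triv

namespace LocalCoords
variable {𝔓} (t : 𝔓.LocalCoords)

/-- The common domain in `M`. -/
def dom : Set M := t.chart.source ∩ t.triv.baseSet

/-- The section `x ↦ (x, 1)` of `P` defined by the trivialisation. -/
def sec (x : M) : P := t.triv.toOpenPartialHomeomorph.symm (x, 1)

/-- The second component of the trivialisation. -/
def grp (u : P) : G := (t.triv u).2

/-- The coordinates `(xⁱ, A_j^α)` on the bundle of connections: `A_j` is the element of the Lie algebra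
`T_1 G = ℝᵐ` such that the horizontal lift of `∂/∂xʲ` at `(x, 1)` is `∂/∂xʲ - A_j`. The `A_j` are
collected in the linear map `ℝⁿ → T_1 G` taking the `j`-th basis vector to `A_j`. -/
def coord (c : 𝔓.Conn) : Coord n × (Coord n →L[ℝ] Coord m) :=
  (t.chart c.base,
    -(tmap (𝓡 k) (𝓡 m) t.grp (t.sec c.base) ∘L
      c.lift (t.sec c.base) ∘L
      tmap (𝓡 n) (𝓡 n) t.chart.symm (t.chart c.base)))

theorem isOpen_dom : IsOpen t.dom := t.chart.open_source.inter t.triv.open_baseSet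

theorem mem_target {x : M} (hx : x ∈ t.triv.baseSet) (g : G) : (x, g) ∈ t.triv.target := by
  rw [t.triv.target_eq]; exact ⟨hx, trivial⟩

theorem mem_source {u : P} (hu : 𝔓.proj u ∈ t.triv.baseSet) : u ∈ t.triv.source := by
  rw [t.triv.source_eq]; exact hu

theorem triv_apply {u : P} (hu : 𝔓.proj u ∈ t.triv.baseSet) : t.triv u = (𝔓.proj u, t.grp u) :=
  Prod.ext (t.triv.proj_toFun u (t.mem_source hu)) rfl

theorem triv_sec {x : M} (hx : x ∈ t.triv.baseSet) : t.triv (t.sec x) = (x, 1) :=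
  t.triv.toOpenPartialHomeomorph.right_inv (t.mem_target hx 1)

theorem proj_sec {x : M} (hx : x ∈ t.triv.baseSet) : 𝔓.proj (t.sec x) = x := by
  have h : t.sec x ∈ t.triv.source := t.triv.toOpenPartialHomeomorph.map_target (t.mem_target hx 1)
  have h2 : (t.triv (t.sec x)).1 = 𝔓.proj (t.sec x) := t.triv.proj_toFun _ h
  rw [← h2, t.triv_sec hx]

theorem grp_sec {x : M} (hx : x ∈ t.triv.baseSet) : t.grp (t.sec x) = 1 := by
  unfold grp; rw [t.triv_sec hx]

theorem grp_act {u : P} (hu : 𝔓.proj u ∈ t.triv.baseSet) (g : G) :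
    t.grp (𝔓.act u g) = t.grp u * g := t.triv_mem.equivariant u (t.mem_source hu) g

theorem eq_of {u w : P} (hu : 𝔓.proj u ∈ t.triv.baseSet) (h : 𝔓.proj u = 𝔓.proj w)
    (h' : t.grp u = t.grp w) : u = w := by
  have hw : 𝔓.proj w ∈ t.triv.baseSet := h ▸ hu
  refine t.triv.toOpenPartialHomeomorph.injOn (t.mem_source hu) (t.mem_source hw) ?_
  change t.triv u = t.triv w
  rw [t.triv_apply hu, t.triv_apply hw, h, h']

theorem act_sec {u : P} (hu : 𝔓.proj u ∈ t.triv.baseSet) :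
    𝔓.act (t.sec (𝔓.proj u)) (t.grp u) = u := by
  have h : 𝔓.proj (t.sec (𝔓.proj u)) = 𝔓.proj u := t.proj_sec hu
  symm
  refine t.eq_of hu (by rw [𝔓.proj_act, h]) ?_
  rw [t.grp_act (by rwa [h]), t.grp_sec hu, one_mul]

theorem contMDiffAt_sec {x : M} (hx : x ∈ t.triv.baseSet) :
    ContMDiffAt (𝓡 n) (𝓡 k) ∞ t.sec x := by
  have h := (t.triv_mem.contMDiffOn_symm (x, 1) (t.mem_target hx 1)).contMDiffAt
    (t.triv.open_target.mem_nhds (t.mem_target hx 1))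
  exact h.comp x (contMDiffAt_id.prodMk contMDiffAt_const)

theorem contMDiffAt_grp {u : P} (hu : 𝔓.proj u ∈ t.triv.baseSet) :
    ContMDiffAt (𝓡 k) (𝓡 m) ∞ t.grp u := by
  have h := (t.triv_mem.contMDiffOn u (t.mem_source hu)).contMDiffAt
    (t.triv.open_source.mem_nhds (t.mem_source hu))
  exact contMDiffAt_snd.comp u h

theorem eventually_base {u : P} (hu : 𝔓.proj u ∈ t.triv.baseSet) :
    ∀ᶠ w in 𝓝 u, 𝔓.proj w ∈ t.triv.baseSet :=
  𝔓.contMDiff_proj.continuous.continuousAt.eventually_mem (t.triv.open_baseSet.mem_nhds hu)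

theorem mdiff_act_left (g : G) (u : P) :
    MDifferentiableAt (𝓡 k) (𝓡 k) (fun w => 𝔓.act w g) u :=
  ((𝔓.contMDiff_act.comp (contMDiff_id.prodMk contMDiff_const)).mdifferentiable (by simp)) u

theorem mdiff_act_right (u : P) (g : G) :
    MDifferentiableAt (𝓡 m) (𝓡 k) (fun h => 𝔓.act u h) g :=
  ((𝔓.contMDiff_act.comp (contMDiff_const.prodMk contMDiff_id)).mdifferentiable (by simp)) g

theorem decomp {x : M} (hx : x ∈ t.triv.baseSet) :
    ContinuousLinearMap.id ℝ (Coord k) =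
      tmap (𝓡 n) (𝓡 k) t.sec x ∘L tmap (𝓡 k) (𝓡 n) 𝔓.proj (t.sec x) +
      tmap (𝓡 m) (𝓡 k) (fun h => 𝔓.act (t.sec x) h) 1 ∘L tmap (𝓡 k) (𝓡 m) t.grp (t.sec x) := by
  have hs : 𝔓.proj (t.sec x) ∈ t.triv.baseSet := by rwa [t.proj_sec hx]
  have h1 : tmap (𝓡 k) (𝓡 k) (fun u : P => u) (t.sec x) =
      tmap (𝓡 k) (𝓡 k) (fun u => 𝔓.act (t.sec (𝔓.proj u)) (t.grp u)) (t.sec x) := by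
    apply tmap_congr
    filter_upwards [t.eventually_base hs] with u hu using (t.act_sec hu).symm
  rw [tmap_id] at h1
  rw [h1]
  have hp : MDifferentiableAt (𝓡 k) (𝓡 n) 𝔓.proj (t.sec x) :=
    𝔓.contMDiff_proj.mdifferentiable (by simp) _
  have hsec : MDifferentiableAt (𝓡 n) (𝓡 k) t.sec x := (t.contMDiffAt_sec hx).mdifferentiableAt (by simp)
  have h2 := tmap_comp₂ (I := 𝓡 k) (I' := 𝓡 k) (I'' := 𝓡 m) (I₃ := 𝓡 k)
    (f := fun u => t.sec (𝔓.proj u)) (g := t.grp) (fun q : P × G => 𝔓.act q.1 q.2) (t.sec x)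
    (y := t.sec x) (z := 1) (by rw [t.proj_sec hx]) (t.grp_sec hx)
    (𝔓.contMDiff_act.mdifferentiable (by simp) _)
    (MDifferentiableAt.comp_of_eq (g := t.sec) (f := 𝔓.proj) _ hsec hp (t.proj_sec hx))
    ((t.contMDiffAt_grp hs).mdifferentiableAt (by simp))
  rw [h2]
  congr 1
  have h3 : (fun a => 𝔓.act a (1 : G)) = fun a : P => a := funext 𝔓.act_one
  rw [h3, tmap_id, tmap_comp_of_eq _ (t.proj_sec hx) hsec hp]
  rfl



theorem contMDiffAt_chart {x : M} (hx : x ∈ t.chart.source) :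
    ContMDiffAt (𝓡 n) (𝓡 n) ∞ t.chart x :=
  (contMDiffOn_of_mem_maximalAtlas t.chart_mem x hx).contMDiffAt (t.chart.open_source.mem_nhds hx)

theorem contMDiffAt_chart_symm {y : Coord n} (hy : y ∈ t.chart.target) :
    ContMDiffAt (𝓡 n) (𝓡 n) ∞ t.chart.symm y :=
  (contMDiffOn_symm_of_mem_maximalAtlas t.chart_mem y hy).contMDiffAt
    (t.chart.open_target.mem_nhds hy)

theorem tmap_symm_comp {x : M} (hx : x ∈ t.chart.source) :
    tmap (𝓡 n) (𝓡 n) t.chart.symm (t.chart x) ∘L tmap (𝓡 n) (𝓡 n) t.chart x =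
      ContinuousLinearMap.id ℝ (Coord n) := by
  have hd := (t.contMDiffAt_chart_symm (t.chart.map_source hx)).mdifferentiableAt (by simp)
  rw [← tmap_comp x hd ((t.contMDiffAt_chart hx).mdifferentiableAt (by simp)),
    tmap_congr (t.chart.eventually_left_inverse hx)]
  exact tmap_id x

theorem tmap_comp_symm {x : M} (hx : x ∈ t.chart.source) :
    tmap (𝓡 n) (𝓡 n) t.chart x ∘L tmap (𝓡 n) (𝓡 n) t.chart.symm (t.chart x) =
      ContinuousLinearMap.id ℝ (Coord n) := by
  have hy := t.chart.map_source hx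
  have hd := (t.contMDiffAt_chart_symm hy).mdifferentiableAt (by simp)
  rw [← tmap_comp_of_eq (t.chart x) (t.chart.left_inv hx)
    ((t.contMDiffAt_chart hx).mdifferentiableAt (by simp)) hd,
    tmap_congr (t.chart.eventually_right_inverse hy)]
  exact tmap_id _

theorem lift_sec (c : 𝔓.Conn) (hc : c.base ∈ t.dom) :
    c.lift (t.sec c.base) = tmap (𝓡 n) (𝓡 k) t.sec c.base -
      tmap (𝓡 m) (𝓡 k) (fun h => 𝔓.act (t.sec c.base) h) 1 ∘L (t.coord c).2 ∘L
        tmap (𝓡 n) (𝓡 n) t.chart c.base := by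
  have h1 : tmap (𝓡 k) (𝓡 n) 𝔓.proj (t.sec c.base) ∘L
      c.lift (t.sec c.base) = ContinuousLinearMap.id ℝ (Coord n) :=
    c.proj_lift _ (t.proj_sec hc.2)
  have h2 := congrArg (fun T : Coord k →L[ℝ] Coord k =>
    T ∘L c.lift (t.sec c.base)) (t.decomp hc.2)
  have h3 := t.tmap_symm_comp hc.1
  ext1 v
  have h1 := fun v => congrArg (fun T : Coord n →L[ℝ] Coord n => T v) h1
  have h2 := congrArg (fun T : Coord n →L[ℝ] Coord k => T v) h2
  have h3 := congrArg (fun T : Coord n →L[ℝ] Coord n => T v) h3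
  simp only [ContinuousLinearMap.comp_apply, _root_.add_apply,
    ContinuousLinearMap.id_apply] at h1 h2 h3
  rw [h1] at h2
  simp only [coord, _root_.sub_apply, ContinuousLinearMap.comp_apply,
    _root_.neg_apply, map_neg, sub_neg_eq_add, h3]
  exact h2

open Classical in
/-- The connection with given coordinates. -/
def ofCoord (x : M) (hx : x ∈ t.dom) (A : Coord n →L[ℝ] Coord m) : 𝔓.Conn where
  base := x
  lift u := if 𝔓.proj u = x then
      (tmap (𝓡 k) (𝓡 k) (fun w => 𝔓.act w (t.grp u)) (t.sec x) ∘L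
        (tmap (𝓡 n) (𝓡 k) t.sec x - tmap (𝓡 m) (𝓡 k) (fun h => 𝔓.act (t.sec x) h) 1 ∘L A ∘L
          tmap (𝓡 n) (𝓡 n) t.chart x)) else 0
  proj_lift u hu := by
    rw [if_pos hu]
    subst hu
    have hp : ∀ u, MDifferentiableAt (𝓡 k) (𝓡 n) 𝔓.proj u := fun u =>
      𝔓.contMDiff_proj.mdifferentiable (by simp) u
    have h1 := tmap_comp_of_eq (I := 𝓡 k) (t.sec (𝔓.proj u)) (t.act_sec hx.2) (hp u)
      (mdiff_act_left (𝔓 := 𝔓) (t.grp u) _)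
    simp only [𝔓.proj_act] at h1
    have h2 := tmap_comp_of_eq (I := 𝓡 n) (𝔓.proj u) rfl (hp (t.sec (𝔓.proj u)))
      ((t.contMDiffAt_sec hx.2).mdifferentiableAt (by simp))
    have h2' : (fun z => 𝔓.proj (t.sec z)) =ᶠ[𝓝 (𝔓.proj u)] fun z => z := by
      filter_upwards [t.triv.open_baseSet.mem_nhds hx.2] with z hz using t.proj_sec hz
    rw [tmap_congr h2', tmap_id] at h2
    have h3 := tmap_comp_of_eq (I := 𝓡 m) (f := fun h => 𝔓.act (t.sec (𝔓.proj u)) h) 1 (𝔓.act_one _)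
      (hp (t.sec (𝔓.proj u))) (mdiff_act_right (𝔓 := 𝔓) _ _)
    simp only [𝔓.proj_act] at h3
    rw [tmap_const] at h3
    rw [← ContinuousLinearMap.comp_assoc, ← h1, ContinuousLinearMap.comp_sub, ← h2,
      ← ContinuousLinearMap.comp_assoc, ← h3]
    simp
  lift_act u hu g := by
    rw [if_pos hu, if_pos (by rw [𝔓.proj_act, hu]), t.grp_act (by rw [hu]; exact hx.2)]
    subst hu
    simp only [𝔓.act_mul]
    rw [tmap_comp_of_eq (I := 𝓡 k) (f := fun w => 𝔓.act w (t.grp u)) (g := fun w => 𝔓.act w g)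
      (t.sec (𝔓.proj u)) (t.act_sec hx.2)
      (mdiff_act_left (𝔓 := 𝔓) g _) (mdiff_act_left (𝔓 := 𝔓) (t.grp u) _)]
    rfl
  lift_off u hu := if_neg hu

theorem ofCoord_base (x : M) (hx : x ∈ t.dom) (A : Coord n →L[ℝ] Coord m) : (t.ofCoord x hx A).base = x := rfl

theorem coord_ofCoord (x : M) (hx : x ∈ t.dom) (A : Coord n →L[ℝ] Coord m) :
    t.coord (t.ofCoord x hx A) = (t.chart x, A) := by
  have hs := t.proj_sec hx.2
  have hl : (t.ofCoord x hx A).lift (t.sec x) =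
      tmap (𝓡 n) (𝓡 k) t.sec x - tmap (𝓡 m) (𝓡 k) (fun h => 𝔓.act (t.sec x) h) 1 ∘L A ∘L
          tmap (𝓡 n) (𝓡 n) t.chart x := by
    simp only [ofCoord, if_pos hs, t.grp_sec hx.2, 𝔓.act_one]
    rw [tmap_id]
    rfl
  have hg : MDifferentiableAt (𝓡 k) (𝓡 m) t.grp (t.sec x) :=
    (t.contMDiffAt_grp (by rw [hs]; exact hx.2)).mdifferentiableAt (by simp)
  have h2 := tmap_comp_of_eq (I := 𝓡 n) x rfl hg
      ((t.contMDiffAt_sec hx.2).mdifferentiableAt (by simp))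
  have h2' : (fun z => t.grp (t.sec z)) =ᶠ[𝓝 x] fun z => 1 := by
    filter_upwards [t.triv.open_baseSet.mem_nhds hx.2] with z hz using t.grp_sec hz
  rw [tmap_congr h2', tmap_const] at h2
  have h3 := tmap_comp_of_eq (I := 𝓡 m) (f := fun h => 𝔓.act (t.sec x) h) 1 (𝔓.act_one _)
      hg (mdiff_act_right (𝔓 := 𝔓) _ _)
  have h3' : (fun h => t.grp (𝔓.act (t.sec x) h)) = fun h => h := by
    funext h
    rw [t.grp_act (by rw [hs]; exact hx.2), t.grp_sec hx.2, one_mul]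
  rw [h3', tmap_id] at h3
  refine Prod.ext rfl ?_
  change -(_ ∘L (t.ofCoord x hx A).lift (t.sec x) ∘L _) = A
  rw [hl, ContinuousLinearMap.sub_comp, ContinuousLinearMap.comp_sub,
    ← ContinuousLinearMap.comp_assoc]
  rw [ofCoord_base, ← h2, ContinuousLinearMap.comp_assoc, ContinuousLinearMap.comp_assoc,
    t.tmap_comp_symm hx.1, ← ContinuousLinearMap.comp_assoc, ← h3]
  simp


theorem coord_injOn : Set.InjOn t.coord {c | c.base ∈ t.dom} := by
  intro c hc d hd h
  have hb : c.base = d.base := t.chart.injOn hc.1 hd.1 (congrArg Prod.fst h)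
  have hs : c.lift (t.sec c.base) = d.lift (t.sec c.base) := by
    rw [t.lift_sec c hc, h, hb, t.lift_sec d hd]
  refine Conn.ext_lift hb fun u hu => ?_
  have hu' : 𝔓.proj u ∈ t.triv.baseSet := by rw [hu]; exact hc.2
  have hsp := t.proj_sec hc.2
  rw [← t.act_sec hu', hu, c.lift_act _ hsp, d.lift_act _ (hsp.trans hb), hs]

/-- The range of the coordinates. -/
def range : Set (Coord n × (Coord n →L[ℝ] Coord m)) :=
  {q | q.1 ∈ t.chart.target ∧ t.chart.symm q.1 ∈ t.triv.baseSet}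

theorem isOpen_range : IsOpen t.range := by
  have h : IsOpen (t.chart.target ∩ t.chart.symm ⁻¹' t.triv.baseSet) :=
    t.chart.isOpen_inter_preimage_symm t.triv.open_baseSet
  exact h.preimage continuous_fst

theorem symm_mem_dom {q : Coord n × (Coord n →L[ℝ] Coord m)} (hq : q ∈ t.range) :
    t.chart.symm q.1 ∈ t.dom := ⟨t.chart.map_target hq.1, hq.2⟩

theorem coord_mapsTo {c : 𝔓.Conn} (hc : c.base ∈ t.dom) : t.coord c ∈ t.range := by
  refine ⟨t.chart.map_source hc.1, ?_⟩
  change t.chart.symm (t.chart c.base) ∈ _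
  rw [t.chart.left_inv hc.1]
  exact hc.2

theorem coord_bijOn : Set.BijOn t.coord {c | c.base ∈ t.dom} t.range := by
  refine ⟨fun c hc => t.coord_mapsTo hc, t.coord_injOn, fun q hq => ?_⟩
  refine ⟨t.ofCoord _ (t.symm_mem_dom hq) q.2, t.symm_mem_dom hq, ?_⟩
  rw [t.coord_ofCoord, t.chart.right_inv hq.1]

variable (𝔓) in
theorem exists_at [IsManifold (𝓡 n) ∞ M] (x : M) : ∃ t : 𝔓.LocalCoords, x ∈ t.dom := by
  obtain ⟨e, he, he'⟩ := 𝔓.locally_trivial x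
  have hx : chartAt (Coord n) x ∈ IsManifold.maximalAtlas (𝓡 n) ∞ M := by
    exact IsManifold.chart_mem_maximalAtlas x
  exact ⟨⟨chartAt (Coord n) x, hx, e, he'⟩, mem_chart_source _ x, he⟩


section
variable [LieGroup (𝓡 m) ∞ G]

/-- The transition function of two trivialisations. -/
def transFun (t' : 𝔓.LocalCoords) (x : M) : G := t'.grp (t.sec x)

theorem mdiff_mul (a b c : G) : MDifferentiableAt (𝓡 m) (𝓡 m) (fun γ => a * γ * b) c := by
  have h : ContMDiff (𝓡 m) (𝓡 m) ∞ (fun γ => a * γ * b) :=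
    (contMDiff_const.mul contMDiff_id).mul contMDiff_const
  exact h.mdifferentiable (by simp) c

theorem contMDiffAt_transFun (t' : 𝔓.LocalCoords) {x : M} (hx : x ∈ t.dom) (hx' : x ∈ t'.dom) :
    ContMDiffAt (𝓡 n) (𝓡 m) ∞ (t.transFun t') x :=
  (t'.contMDiffAt_grp (u := t.sec x) (by rw [t.proj_sec hx.2]; exact hx'.2)).comp x
    (t.contMDiffAt_sec hx.2)

theorem coord_change (t' : 𝔓.LocalCoords) (c : 𝔓.Conn) (hc : c.base ∈ t.dom)
    (hc' : c.base ∈ t'.dom) :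
    (t'.coord c).2 =
      tmap (𝓡 m) (𝓡 m) (fun γ => t.transFun t' c.base * γ * (t.transFun t' c.base)⁻¹) 1 ∘L
        (t.coord c).2 ∘L
        tmap (𝓡 n) (𝓡 n) (fun z => t.chart (t'.chart.symm z)) (t'.chart c.base) -
      tmap (𝓡 n) (𝓡 m) (fun z => t.transFun t' (t'.chart.symm z) * (t.transFun t' c.base)⁻¹)
        (t'.chart c.base) := by
  set x := c.base with hx
  set g := (t.transFun t' x)⁻¹ with hg
  have hs : 𝔓.proj (t.sec x) = x := t.proj_sec hc.2
  have hs' : 𝔓.proj (t.sec x) ∈ t'.triv.baseSet := by rw [hs]; exact hc'.2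
  have hsec : t'.sec x = 𝔓.act (t.sec x) g := by
    have h0 := t'.proj_sec hc'.2
    refine t'.eq_of (by rw [h0]; exact hc'.2) (by rw [𝔓.proj_act, h0, hs]) ?_
    rw [t'.grp_sec hc'.2, t'.grp_act hs', hg]
    exact (mul_inv_cancel _).symm
  have hgr : MDifferentiableAt (𝓡 k) (𝓡 m) t'.grp (t'.sec x) :=
    (t'.contMDiffAt_grp (by rw [t'.proj_sec hc'.2]; exact hc'.2)).mdifferentiableAt (by simp)
  have hgr' : MDifferentiableAt (𝓡 k) (𝓡 m) (fun u => t'.grp u * g) (t.sec x) :=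
    (((t'.contMDiffAt_grp hs').mul contMDiffAt_const)).mdifferentiableAt (by simp)
  have hσ : MDifferentiableAt (𝓡 n) (𝓡 k) t.sec x :=
    (t.contMDiffAt_sec hc.2).mdifferentiableAt (by simp)
  have hy' : MDifferentiableAt (𝓡 n) (𝓡 n) t'.chart.symm (t'.chart x) :=
    (t'.contMDiffAt_chart_symm (t'.chart.map_source hc'.1)).mdifferentiableAt (by simp)
  have hφ : MDifferentiableAt (𝓡 n) (𝓡 n) t.chart x :=
    (t.contMDiffAt_chart hc.1).mdifferentiableAt (by simp)
  have hli : t'.chart.symm (t'.chart x) = x := t'.chart.left_inv hc'.1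
  have e1 : tmap (𝓡 k) (𝓡 m) t'.grp (t'.sec x) ∘L
      tmap (𝓡 k) (𝓡 k) (fun w => 𝔓.act w g) (t.sec x) =
      tmap (𝓡 k) (𝓡 m) (fun u => t'.grp u * g) (t.sec x) := by
    rw [← tmap_comp_of_eq (I := 𝓡 k) (t.sec x) hsec.symm hgr (mdiff_act_left (𝔓 := 𝔓) g _)]
    apply tmap_congr
    filter_upwards [t'.eventually_base hs'] with u hu using t'.grp_act hu g
  have e2 : tmap (𝓡 n) (𝓡 m) (fun z => t.transFun t' z * g) x =
      tmap (𝓡 k) (𝓡 m) (fun u => t'.grp u * g) (t.sec x) ∘L tmap (𝓡 n) (𝓡 k) t.sec x :=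
    tmap_comp x hgr' hσ
  have e3 : tmap (𝓡 m) (𝓡 m) (fun γ => t.transFun t' x * γ * g) 1 =
      tmap (𝓡 k) (𝓡 m) (fun u => t'.grp u * g) (t.sec x) ∘L
        tmap (𝓡 m) (𝓡 k) (fun h => 𝔓.act (t.sec x) h) 1 := by
    rw [← tmap_comp_of_eq (I := 𝓡 m) 1 (𝔓.act_one _) hgr' (mdiff_act_right (𝔓 := 𝔓) _ _)]
    congr 1
    funext γ
    rw [t'.grp_act hs']
    rfl
  have htr : MDifferentiableAt (𝓡 n) (𝓡 m) (fun z => t.transFun t' z * g) x :=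
    ((t.contMDiffAt_transFun t' hc hc').mul contMDiffAt_const).mdifferentiableAt (by simp)
  rw [tmap_comp_of_eq (I := 𝓡 n) (g := fun z => t.transFun t' z * g) (t'.chart x) hli htr hy',
    tmap_comp_of_eq (I := 𝓡 n) (g := t.chart) (t'.chart x) hli hφ hy', e2, e3]
  have hl := t.lift_sec c hc
  have hl' : c.lift (t'.sec x) =
      tmap (𝓡 k) (𝓡 k) (fun w => 𝔓.act w g) (t.sec x) ∘L c.lift (t.sec x) := by
    rw [hsec]; exact c.lift_act _ hs g
  rw [← hx] at hl
  change -(tmap (𝓡 k) (𝓡 m) t'.grp (t'.sec x) ∘L c.lift (t'.sec x) ∘L _) = _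
  rw [hl', hl, ← e1]
  ext1 v
  simp only [ContinuousLinearMap.comp_apply, _root_.sub_apply, _root_.neg_apply, map_sub]
  abel


/-- The overlap of two coordinate domains, in the first coordinates. -/
def overlap (t' : 𝔓.LocalCoords) : Set (Coord n) :=
  {y | y ∈ t.chart.target ∧ t.chart.symm y ∈ t.dom ∧ t.chart.symm y ∈ t'.dom}

theorem isOpen_overlap (t' : 𝔓.LocalCoords) : IsOpen (t.overlap t') :=
  t.chart.isOpen_inter_preimage_symm (t.isOpen_dom.inter t'.isOpen_dom)

/-- The change of coordinates on the bundle of connections. -/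
def transition (t' : 𝔓.LocalCoords) (q : Coord n × (Coord n →L[ℝ] Coord m)) :
    Coord n × (Coord n →L[ℝ] Coord m) :=
  (t'.chart (t.chart.symm q.1),
    tmap (𝓡 m) (𝓡 m)
        (fun γ => t.transFun t' (t.chart.symm q.1) * γ * (t.transFun t' (t.chart.symm q.1))⁻¹) 1 ∘L
      q.2 ∘L
      tmap (𝓡 n) (𝓡 n) (fun z => t.chart (t'.chart.symm z)) (t'.chart (t.chart.symm q.1)) -
    tmap (𝓡 n) (𝓡 m) (fun z => t.transFun t' (t'.chart.symm z) *
      (t.transFun t' (t'.chart.symm (t'.chart (t.chart.symm q.1))))⁻¹) (t'.chart (t.chart.symm q.1)))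

theorem transition_coord (t' : 𝔓.LocalCoords) (c : 𝔓.Conn) (hc : c.base ∈ t.dom)
    (hc' : c.base ∈ t'.dom) : t'.coord c = t.transition t' (t.coord c) := by
  have h1 : t.chart.symm (t.coord c).1 = c.base := t.chart.left_inv hc.1
  refine Prod.ext ?_ ?_
  · simp only [transition, h1]
    rfl
  · rw [t.coord_change t' c hc hc']
    simp only [transition, h1, t'.chart.left_inv hc'.1]

theorem contDiffAt_transition (t' : 𝔓.LocalCoords) {q : Coord n × (Coord n →L[ℝ] Coord m)}
    (hq : q.1 ∈ t.overlap t') : ContDiffAt ℝ ∞ (t.transition t') q := by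
  obtain ⟨h1, h2, h3⟩ := hq
  have hs : ContMDiffAt (𝓡 n) (𝓡 n) ∞ t.chart.symm q.1 := t.contMDiffAt_chart_symm h1
  have hθ' : ContMDiffAt (𝓡 n) (𝓡 n) ∞ (fun y => t'.chart (t.chart.symm y)) q.1 :=
    (t'.contMDiffAt_chart h3.1).comp q.1 hs
  have hθ : ContDiffAt ℝ ∞ (fun y => t'.chart (t.chart.symm y)) q.1 :=
    contMDiffAt_iff_contDiffAt.1 hθ'
  set z := t'.chart (t.chart.symm q.1) with hz
  have hzt : z ∈ t'.chart.target := t'.chart.map_source h3.1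
  have hzs : t'.chart.symm z = t.chart.symm q.1 := t'.chart.left_inv h3.1
  have hs' : ContMDiffAt (𝓡 n) (𝓡 n) ∞ t'.chart.symm z := t'.contMDiffAt_chart_symm hzt
  have hW0 : ContDiffAt ℝ ∞ (fun z => t.chart (t'.chart.symm z)) z := by
    rw [← contMDiffAt_iff_contDiffAt]
    exact ContMDiffAt.comp (g := t.chart) z (t.contMDiffAt_chart (by rw [hzs]; exact h2.1)) hs'
  have hW : ContDiffAt ℝ ∞
      (fun y => tmap (𝓡 n) (𝓡 n) (fun z => t.chart (t'.chart.symm z)) y) z := by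
    have : ContDiffAt ℝ ∞ (fderiv ℝ (fun z => t.chart (t'.chart.symm z))) z :=
      hW0.fderiv_right (by simp)
    refine this.congr_of_eventuallyEq (Filter.Eventually.of_forall fun y => ?_)
    exact mfderiv_eq_fderiv
  have hh : ContMDiffAt (𝓡 n) (𝓡 m) ∞ (fun y => t.transFun t' (t.chart.symm y)) q.1 :=
    (t.contMDiffAt_transFun t' h2 h3).comp q.1 hs
  have hS : ContDiffAt ℝ ∞ (fun y => tmap (𝓡 m) (𝓡 m)
      (fun γ => t.transFun t' (t.chart.symm y) * γ * (t.transFun t' (t.chart.symm y))⁻¹) 1) q.1 := by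
    refine contDiffAt_tmap_const (1 : G)
      (fun y γ => t.transFun t' (t.chart.symm y) * γ * (t.transFun t' (t.chart.symm y))⁻¹) q.1 ?_
      (Filter.Eventually.of_forall fun y => by simp)
    have hh' : ContMDiffAt ((𝓡 n).prod (𝓡 m)) (𝓡 m) ∞
        (fun w : Coord n × G => t.transFun t' (t.chart.symm w.1)) (q.1, 1) :=
      ContMDiffAt.comp (g := fun y => t.transFun t' (t.chart.symm y)) (f := Prod.fst)
        (q.1, (1 : G)) hh contMDiffAt_fst
    exact (hh'.mul contMDiffAt_snd).mul hh'.inv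
  have hk : ContMDiffAt (𝓡 n) (𝓡 m) ∞ (fun y => t.transFun t' (t'.chart.symm y)) z :=
    ContMDiffAt.comp (g := t.transFun t') z
      (t.contMDiffAt_transFun t' (by rw [hzs]; exact h2) (by rw [hzs]; exact h3)) hs'
  have hR : ContDiffAt ℝ ∞ (fun y => tmap (𝓡 n) (𝓡 m)
      (fun w => t.transFun t' (t'.chart.symm w) * (t.transFun t' (t'.chart.symm y))⁻¹) y) z := by
    refine contDiffAt_tmap_self (1 : G)
      (fun y w => t.transFun t' (t'.chart.symm w) * (t.transFun t' (t'.chart.symm y))⁻¹) z ?_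
      (Filter.Eventually.of_forall fun y => by simp)
    have hk1 : ContMDiffAt ((𝓡 n).prod (𝓡 n)) (𝓡 m) ∞
        (fun w : Coord n × Coord n => t.transFun t' (t'.chart.symm w.1)) (z, z) :=
      ContMDiffAt.comp (g := fun y => t.transFun t' (t'.chart.symm y)) (f := Prod.fst)
        (z, z) hk contMDiffAt_fst
    have hk2 : ContMDiffAt ((𝓡 n).prod (𝓡 n)) (𝓡 m) ∞
        (fun w : Coord n × Coord n => t.transFun t' (t'.chart.symm w.2)) (z, z) :=
      ContMDiffAt.comp (g := fun y => t.transFun t' (t'.chart.symm y)) (f := Prod.snd)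
        (z, z) hk contMDiffAt_snd
    exact hk2.mul hk1.inv
  have f1 : ContDiffAt ℝ ∞ (fun q : Coord n × (Coord n →L[ℝ] Coord m) => q.1) q := contDiffAt_fst
  have f2 : ContDiffAt ℝ ∞ (fun q : Coord n × (Coord n →L[ℝ] Coord m) => q.2) q := contDiffAt_snd
  have g1 := ContDiffAt.comp q hθ f1
  have g2 := ContDiffAt.comp q hS f1
  have g3 := ContDiffAt.comp q hW g1
  have g4 := ContDiffAt.comp q hR g1
  exact g1.prodMk ((g2.clm_comp (f2.clm_comp g3)).sub g4)

variable [IsManifold (𝓡 n) ∞ M]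

theorem nonempty_conn (t : 𝔓.LocalCoords) : Nonempty 𝔓.Conn := by
  obtain ⟨t', ht'⟩ := exists_at 𝔓 (t.chart.symm 0)
  exact ⟨t'.ofCoord _ ht' 0⟩

/-- The coordinates, as a bijection of the part of `C(P)` over the domain onto the range. -/
def toPartialEquiv : PartialEquiv 𝔓.Conn (Coord n × (Coord n →L[ℝ] Coord m)) :=
  haveI := t.nonempty_conn
  t.coord_bijOn.toPartialEquiv t.coord {c | c.base ∈ t.dom} t.range

theorem toPartialEquiv_symm_base {q : Coord n × (Coord n →L[ℝ] Coord m)} (hq : q ∈ t.range) :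
    (t.toPartialEquiv.symm q).base = t.chart.symm q.1 := by
  have h : t.coord (t.toPartialEquiv.symm q) = q := t.toPartialEquiv.right_inv hq
  have h' : (t.toPartialEquiv.symm q).base ∈ t.dom := t.toPartialEquiv.map_target hq
  have h2 : t.chart (t.toPartialEquiv.symm q).base = q.1 := congrArg Prod.fst h
  rw [← h2, t.chart.left_inv h'.1]

theorem trans_source (t' : 𝔓.LocalCoords) :
    (t.toPartialEquiv.symm.trans t'.toPartialEquiv).source = Prod.fst ⁻¹' t.overlap t' := by
  ext q
  rw [PartialEquiv.trans_source]
  constructor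
  · rintro ⟨h1, h2⟩
    have h1 : q ∈ t.range := h1
    have h2 : (t.toPartialEquiv.symm q).base ∈ t'.dom := h2
    rw [t.toPartialEquiv_symm_base h1] at h2
    exact ⟨h1.1, t.symm_mem_dom h1, h2⟩
  · rintro ⟨h1, h2, h3⟩
    have h : q ∈ t.range := ⟨h1, h2.2⟩
    refine ⟨h, ?_⟩
    change (t.toPartialEquiv.symm q).base ∈ t'.dom
    rwa [t.toPartialEquiv_symm_base h]

theorem contDiffOn_trans (t' : 𝔓.LocalCoords) :
    ContDiffOn ℝ ∞ (t.toPartialEquiv.symm.trans t'.toPartialEquiv)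
      (t.toPartialEquiv.symm.trans t'.toPartialEquiv).source := by
  rw [trans_source]
  intro q hq
  refine ((t.contDiffAt_transition t' hq).contDiffWithinAt).congr_of_mem (fun p hp => ?_) hq
  have h : p ∈ t.range := ⟨hp.1, hp.2.1.2⟩
  have hb := t.toPartialEquiv_symm_base h
  have hr : t.coord (t.toPartialEquiv.symm p) = p := t.toPartialEquiv.right_inv h
  change t'.coord (t.toPartialEquiv.symm p) = _
  rw [t.transition_coord t' _ (by rw [hb]; exact hp.2.1) (by rw [hb]; exact hp.2.2), hr]

end

end LocalCoords

section Manifold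
variable [LieGroup (𝓡 m) ∞ G] [IsManifold (𝓡 n) ∞ M]

/-- The smooth atlas of the bundle of connections given by the coordinates `(xⁱ, A_j^α)`. -/
def connCore : ChartedSpaceCore (Coord n × (Coord n →L[ℝ] Coord m)) 𝔓.Conn where
  atlas := Set.range fun t : 𝔓.LocalCoords => t.toPartialEquiv
  chartAt c := (LocalCoords.exists_at 𝔓 c.base).choose.toPartialEquiv
  mem_chart_source c := (LocalCoords.exists_at 𝔓 c.base).choose_spec
  chart_mem_atlas c := ⟨_, rfl⟩
  open_source := by
    rintro _ _ ⟨t, rfl⟩ ⟨t', rfl⟩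
    rw [t.trans_source t']
    exact (t.isOpen_overlap t').preimage continuous_fst
  continuousOn_toFun := by
    rintro _ _ ⟨t, rfl⟩ ⟨t', rfl⟩
    exact (t.contDiffOn_trans t').continuousOn

instance : TopologicalSpace 𝔓.Conn := 𝔓.connCore.toTopologicalSpace

instance : ChartedSpace (Coord n × (Coord n →L[ℝ] Coord m)) 𝔓.Conn := 𝔓.connCore.toChartedSpace

/-- The coordinates, as a chart of the manifold `C(P)`. -/
def LocalCoords.connChart {𝔓 : PrincipalBundle n m k M G P} (t : 𝔓.LocalCoords) :
    OpenPartialHomeomorph 𝔓.Conn (Coord n × (Coord n →L[ℝ] Coord m)) :=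
  𝔓.connCore.openPartialHomeomorph t.toPartialEquiv ⟨t, rfl⟩

theorem LocalCoords.connChart_mem_atlas {𝔓 : PrincipalBundle n m k M G P} (t : 𝔓.LocalCoords) :
    t.connChart ∈ atlas (Coord n × (Coord n →L[ℝ] Coord m)) 𝔓.Conn := by
  change t.connChart ∈ ⋃ (e : PartialEquiv _ _) (he : e ∈ 𝔓.connCore.atlas), _
  simp only [Set.mem_iUnion]
  exact ⟨_, ⟨t, rfl⟩, rfl⟩

theorem exists_of_mem_atlas {e : OpenPartialHomeomorph 𝔓.Conn (Coord n × (Coord n →L[ℝ] Coord m))}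
    (he : e ∈ atlas (Coord n × (Coord n →L[ℝ] Coord m)) 𝔓.Conn) :
    ∃ t : 𝔓.LocalCoords, e = t.connChart := by
  change e ∈ ⋃ (e : PartialEquiv _ _) (he : e ∈ 𝔓.connCore.atlas), _ at he
  simp only [Set.mem_iUnion] at he
  obtain ⟨_, ⟨t, rfl⟩, h⟩ := he
  exact ⟨t, h⟩

instance : IsManifold 𝓘(ℝ, Coord n × (Coord n →L[ℝ] Coord m)) ∞ 𝔓.Conn := by
  apply isManifold_of_contDiffOn
  intro e e' he he'
  obtain ⟨t, rfl⟩ := 𝔓.exists_of_mem_atlas he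
  obtain ⟨t', rfl⟩ := 𝔓.exists_of_mem_atlas he'
  simp only [modelWithCornersSelf_coe, modelWithCornersSelf_coe_symm, Set.range_id, Set.inter_univ,
    Function.comp_id, Function.id_comp, Set.preimage_id]
  exact t.contDiffOn_trans t'


/-- The projection `p : C(P) → M`. -/
def connProj (c : 𝔓.Conn) : M := c.base

theorem contMDiff_connProj :
    ContMDiff 𝓘(ℝ, Coord n × (Coord n →L[ℝ] Coord m)) (𝓡 n) ∞ 𝔓.connProj := by
  intro c
  obtain ⟨t, ht⟩ := LocalCoords.exists_at 𝔓 c.base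
  have hm := IsManifold.subset_maximalAtlas (I := 𝓘(ℝ, Coord n × (Coord n →L[ℝ] Coord m)))
    (n := ∞) t.connChart_mem_atlas
  have hc : c ∈ t.connChart.source := ht
  have h1 := contMDiffAt_of_mem_maximalAtlas hm hc
  have h2 : ContMDiffAt 𝓘(ℝ, Coord n × (Coord n →L[ℝ] Coord m)) (𝓡 n) ∞
      (fun q : Coord n × (Coord n →L[ℝ] Coord m) => q.1) (t.connChart c) :=
    contDiff_fst.contMDiff.contMDiffAt
  have h3 : ContMDiffAt (𝓡 n) (𝓡 n) ∞ t.chart.symm (t.connChart c).1 :=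
    t.contMDiffAt_chart_symm (t.chart.map_source ht.1)
  have h4 := ContMDiffAt.comp (g := t.chart.symm) c h3 (h2.comp c h1)
  refine h4.congr_of_eventuallyEq ?_
  filter_upwards [t.connChart.open_source.mem_nhds hc] with d hd
  have hd : d.base ∈ t.dom := hd
  exact (t.chart.left_inv hd.1).symm

variable {𝔓}

theorem mdiff_gauge (Φ : 𝔓.gauge) (u : P) : MDifferentiableAt (𝓡 k) (𝓡 k) Φ.1 u :=
  Φ.2.1.mdifferentiable (by simp) u

theorem gauge_proj_symm (Φ : 𝔓.gauge) (u : P) : 𝔓.proj (Φ.1.symm u) = 𝔓.proj u := by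
  have h := Φ.2.2.2.2 (Φ.1.symm u)
  rw [Equiv.apply_symm_apply] at h
  exact h.symm

theorem gauge_symm_act (Φ : 𝔓.gauge) (u : P) (g : G) :
    Φ.1.symm (𝔓.act u g) = 𝔓.act (Φ.1.symm u) g := by
  apply Φ.1.injective
  rw [Φ.2.2.2.1, Equiv.apply_symm_apply, Equiv.apply_symm_apply]

/-- The action `Φ_C` of a gauge transformation `Φ` on connections: the horizontal subspace of the
image at `u` is the image under the tangent map of `Φ` of the horizontal subspace at `Φ⁻¹ u`. (On
connection forms, it is `ω ↦ (Φ⁻¹)^* ω`.) -/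
def gaugeConn (Φ : 𝔓.gauge) (c : 𝔓.Conn) : 𝔓.Conn where
  base := c.base
  lift u := tmap (𝓡 k) (𝓡 k) Φ.1 (Φ.1.symm u) ∘L c.lift (Φ.1.symm u)
  proj_lift u hu := by
    have h := tmap_comp_of_eq (I := 𝓡 k) (f := Φ.1) (g := 𝔓.proj) (Φ.1.symm u)
      (Φ.1.apply_symm_apply u) (𝔓.contMDiff_proj.mdifferentiable (by simp) u) (mdiff_gauge Φ _)
    simp only [Φ.2.2.2.2] at h
    rw [← ContinuousLinearMap.comp_assoc, ← h]
    exact c.proj_lift _ (by rw [gauge_proj_symm, hu])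
  lift_act u hu g := by
    have h1 := tmap_comp_of_eq (I := 𝓡 k) (f := fun w => 𝔓.act w g) (g := Φ.1) (Φ.1.symm u) rfl
      (mdiff_gauge Φ _) (LocalCoords.mdiff_act_left (𝔓 := 𝔓) g _)
    have h2 := tmap_comp_of_eq (I := 𝓡 k) (f := Φ.1) (g := fun w => 𝔓.act w g) (Φ.1.symm u)
      (Φ.1.apply_symm_apply u) (LocalCoords.mdiff_act_left (𝔓 := 𝔓) g _) (mdiff_gauge Φ _)
    simp only [Φ.2.2.2.1] at h1
    rw [gauge_symm_act, c.lift_act _ (by rw [gauge_proj_symm, hu]),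
      ← ContinuousLinearMap.comp_assoc, ← h1, h2, ContinuousLinearMap.comp_assoc]
  lift_off u hu := by
    rw [c.lift_off _ (by rw [gauge_proj_symm]; exact hu), ContinuousLinearMap.comp_zero]

/-- The coordinates obtained by composing the trivialisation with a gauge transformation. -/
def LocalCoords.pull (t : 𝔓.LocalCoords) (Φ : 𝔓.gauge) : 𝔓.LocalCoords where
  chart := t.chart
  chart_mem := t.chart_mem
  triv :=
    { toOpenPartialHomeomorph :=
        (Homeomorph.mk Φ.1 Φ.2.1.continuous Φ.2.2.1.continuous).transOpenPartialHomeomorph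
          t.triv.toOpenPartialHomeomorph
      baseSet := t.triv.baseSet
      open_baseSet := t.triv.open_baseSet
      source_eq := by
        ext u
        change Φ.1 u ∈ t.triv.source ↔ 𝔓.proj u ∈ t.triv.baseSet
        rw [t.triv.source_eq, Set.mem_preimage, Φ.2.2.2.2]
      target_eq := t.triv.target_eq
      proj_toFun := fun u hu => (t.triv.proj_toFun (Φ.1 u) hu).trans (Φ.2.2.2.2 u) }
  triv_mem :=
    { contMDiffOn := t.triv_mem.contMDiffOn.comp Φ.2.1.contMDiffOn fun _ hu => hu
      contMDiffOn_symm := Φ.2.2.1.comp_contMDiffOn t.triv_mem.contMDiffOn_symm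
      equivariant := fun u hu g => by
        change (t.triv (Φ.1 (𝔓.act u g))).2 = (t.triv (Φ.1 u)).2 * g
        rw [Φ.2.2.2.1]
        exact t.triv_mem.equivariant _ hu g }

theorem LocalCoords.coord_gaugeConn (t : 𝔓.LocalCoords) (Φ : 𝔓.gauge) {c : 𝔓.Conn}
    (hc : c.base ∈ t.dom) : t.coord (gaugeConn Φ c) = (t.pull Φ).coord c := by
  refine Prod.ext rfl ?_
  have hb : 𝔓.proj (t.sec c.base) ∈ t.triv.baseSet := by rw [t.proj_sec hc.2]; exact hc.2
  have h := tmap_comp_of_eq (I := 𝓡 k) (f := Φ.1) (g := t.grp) (Φ.1.symm (t.sec c.base))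
    (Φ.1.apply_symm_apply _) ((t.contMDiffAt_grp hb).mdifferentiableAt (by simp)) (mdiff_gauge Φ _)
  change -(tmap (𝓡 k) (𝓡 m) t.grp (t.sec c.base) ∘L
      (tmap (𝓡 k) (𝓡 k) Φ.1 (Φ.1.symm (t.sec c.base)) ∘L c.lift (Φ.1.symm (t.sec c.base))) ∘L _) =
    -(tmap (𝓡 k) (𝓡 m) (fun z => t.grp (Φ.1 z)) (Φ.1.symm (t.sec c.base)) ∘L
      c.lift (Φ.1.symm (t.sec c.base)) ∘L _)
  rw [h]
  rfl

theorem contMDiff_gaugeConn (Φ : 𝔓.gauge) :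
    ContMDiff 𝓘(ℝ, Coord n × (Coord n →L[ℝ] Coord m)) 𝓘(ℝ, Coord n × (Coord n →L[ℝ] Coord m)) ∞
      (gaugeConn Φ) := by
  intro c
  obtain ⟨t, ht⟩ := LocalCoords.exists_at 𝔓 c.base
  have hm := fun t : 𝔓.LocalCoords =>
    IsManifold.subset_maximalAtlas (I := 𝓘(ℝ, Coord n × (Coord n →L[ℝ] Coord m)))
      (n := ∞) t.connChart_mem_atlas
  have hc : c ∈ (t.pull Φ).connChart.source := ht
  have h1 := contMDiffAt_of_mem_maximalAtlas (hm (t.pull Φ)) hc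
  have hg : gaugeConn Φ c ∈ t.connChart.source := ht
  have he : t.connChart (gaugeConn Φ c) = (t.pull Φ).connChart c := t.coord_gaugeConn Φ ht
  have h2 := contMDiffAt_symm_of_mem_maximalAtlas (hm t) (t.connChart.map_source hg)
  rw [he] at h2
  refine (h2.comp c h1).congr_of_eventuallyEq ?_
  filter_upwards [(t.pull Φ).connChart.open_source.mem_nhds hc] with d hd
  have hd' : gaugeConn Φ d ∈ t.connChart.source := hd
  have he' : t.connChart (gaugeConn Φ d) = (t.pull Φ).connChart d := t.coord_gaugeConn Φ hd
  change _ = t.connChart.symm ((t.pull Φ).connChart d)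
  rw [← he', t.connChart.left_inv hd']

/-- `Φ_C` as a smooth fibred map of `C(P)` over the identity. -/
def gaugeMap (Φ : 𝔓.gauge) :
    FibredMap n (Coord n →L[ℝ] Coord m) 𝔓.connProj where
  toFun := gaugeConn Φ
  smooth := contMDiff_gaugeConn Φ
  proj_toFun _ := rfl

variable (𝔓) in
/-- The first jet bundle `J¹C` of the bundle of connections. -/
abbrev ConnJet : Type _ := FirstJet n (Coord n →L[ℝ] Coord m) 𝔓.connProj

/-- The map `Φ_C⁽¹⁾ : J¹C → J¹C`. -/
def gaugeJet (Φ : 𝔓.gauge) : 𝔓.ConnJet → 𝔓.ConnJet :=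
  (gaugeMap Φ).prolong 𝔓.contMDiff_connProj

/-- Gauge invariance of a Lagrangian `L : J¹C → ℝ`. -/
def IsGaugeInvariant (L : 𝔓.ConnJet → ℝ) : Prop :=
  ∀ Φ : 𝔓.gauge, L ∘ gaugeJet Φ = L

end Manifold

end PrincipalBundle
end PrincipalBundle

end

/-!
The Hamilton–Cartan and the Euler–Lagrange equations are imposed in all fibred coordinate systems,
so they are natural under diffeomorphisms of the total space over the identity of the base, and a
gauge-invariant Lagrangian is carried to itself by such a diffeomorphism.

More precisely, let `Φ : Y → Y` be a fibred diffeomorphism of `p : Y → M` over the identity. If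
`(xⁱ, y^α)` is a fibred coordinate system, so is its pull-back `(xⁱ, y^α ∘ Φ)`
(`FibredChart.pull`). By the chain rule the induced jet coordinates of `Φ⁽¹⁾ j` in the original
system are those of `j` in the pulled-back one (`FibredChart.jetCoord_prolong`). If moreover
`L ∘ Φ⁽¹⁾ = L`, then the coordinate expressions of `L`, and hence the densities `ℓ`, in the two
systems are the same function on the same domain (`FibredChart.localFun_pull`). Therefore the
equations for `Φ⁽¹⁾ ∘ s̄` (or `Φ ∘ s`) in the original coordinates are literally the equations for
`s̄` (or `s`) in the pulled-back coordinates, which hold by assumption. This gives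
`prolong_comp_mem_hamiltonCartanSolutions` and `comp_mem_eulerLagrangeSolutions`.

For the bundle of connections, `Φ ↦ Φ_C` and `Φ ↦ Φ_C⁽¹⁾` are compatible with composition and
identities, again by the chain rule. In particular `Φ_C` is a diffeomorphism with inverse
`(Φ⁻¹)_C`, so the above applies, and the resulting maps on solutions form left actions.
-/

open scoped Manifold ContDiff Topology

noncomputable section

/-! ### Tangent maps of charts -/

section ChartTangent

variable {E N : Type*} [NormedAddCommGroup E] [NormedSpace ℝ E] [TopologicalSpace N]
  [ChartedSpace E N] {e : OpenPartialHomeomorph N E}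

theorem mdifferentiableAt_of_mem_maximalAtlas_top
    (he : e ∈ IsManifold.maximalAtlas 𝓘(ℝ, E) ∞ N) {x : N} (hx : x ∈ e.source) :
    MDifferentiableAt 𝓘(ℝ, E) 𝓘(ℝ, E) e x :=
  (contMDiffAt_of_mem_maximalAtlas he hx).mdifferentiableAt (by simp)

theorem mdifferentiableAt_symm_of_mem_maximalAtlas_top
    (he : e ∈ IsManifold.maximalAtlas 𝓘(ℝ, E) ∞ N) {y : E} (hy : y ∈ e.target) :
    MDifferentiableAt 𝓘(ℝ, E) 𝓘(ℝ, E) e.symm y :=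
  (contMDiffAt_symm_of_mem_maximalAtlas he hy).mdifferentiableAt (by simp)

theorem tmap_chart_symm_comp_tmap_chart (he : e ∈ IsManifold.maximalAtlas 𝓘(ℝ, E) ∞ N) {x : N}
    (hx : x ∈ e.source) :
    tmap 𝓘(ℝ, E) 𝓘(ℝ, E) e.symm (e x) ∘L tmap 𝓘(ℝ, E) 𝓘(ℝ, E) e x =
      ContinuousLinearMap.id ℝ E := by
  rw [← tmap_comp x (mdifferentiableAt_symm_of_mem_maximalAtlas_top he (e.map_source hx))
    (mdifferentiableAt_of_mem_maximalAtlas_top he hx), tmap_congr (e.eventually_left_inverse hx)]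
  exact tmap_id x

end ChartTangent

/-! ### Pull-back of fibred coordinates by a fibred diffeomorphism -/

section Naturality

variable {n : ℕ} {M : Type*} [TopologicalSpace M] [ChartedSpace (Coord n) M]
  {F : Type*} [NormedAddCommGroup F] [NormedSpace ℝ F]
  {Y : Type*} [TopologicalSpace Y] [ChartedSpace (Coord n × F) Y]
  {p : Y → M}

theorem FibredMap.prolong_of_forall_eq {Φ : FibredMap n F p}
    (hp : ContMDiff 𝓘(ℝ, Coord n × F) (𝓡 n) ∞ p)
    (h : ∀ e, Φ.toFun e = e) (j : FirstJet n F p) : Φ.prolong hp j = j := by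
  have hΦ : Φ.toFun = fun e => e := funext h
  refine FirstJet.ext (h _) ?_
  change tmap _ _ Φ.toFun j.pt ∘L j.lin = j.lin
  rw [hΦ, tmap_id, ContinuousLinearMap.id_comp]

theorem FibredMap.prolong_of_forall_comp_eq {Φ Ψ Χ : FibredMap n F p}
    (hp : ContMDiff 𝓘(ℝ, Coord n × F) (𝓡 n) ∞ p)
    (h : ∀ e, Χ.toFun e = Φ.toFun (Ψ.toFun e)) (j : FirstJet n F p) :
    Χ.prolong hp j = Φ.prolong hp (Ψ.prolong hp j) := by
  have hΧ : Χ.toFun = fun e => Φ.toFun (Ψ.toFun e) := funext h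
  refine FirstJet.ext (h _) ?_
  change tmap _ _ Χ.toFun j.pt ∘L j.lin = tmap _ _ Φ.toFun (Ψ.toFun j.pt) ∘L
    (tmap _ _ Ψ.toFun j.pt ∘L j.lin)
  rw [hΧ, tmap_comp j.pt (Φ.smooth.mdifferentiable (by simp) _)
    (Ψ.smooth.mdifferentiable (by simp) _), ContinuousLinearMap.comp_assoc]

namespace FibredChart

variable (c : FibredChart n F p)

theorem isOpen_secDomain {s : M → Y} (hs : Continuous s) : IsOpen (c.secDomain s) :=
  c.base.isOpen_inter_preimage_symm (c.total.open_source.preimage hs)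

/-- The jet coordinates determine the tangent map of the section: in the charts it is the identity
in the base directions and the last jet coordinate in the fibre directions. -/
theorem lin_eq (hp : ContMDiff 𝓘(ℝ, Coord n × F) (𝓡 n) ∞ p) {j : FirstJet n F p}
    (hj : j.pt ∈ c.total.source) :
    j.lin = tmap 𝓘(ℝ, Coord n × F) 𝓘(ℝ, Coord n × F) c.total.symm (c.total j.pt) ∘L
      (ContinuousLinearMap.id ℝ (Coord n)).prod (c.jetCoord j).2.2 ∘L
        tmap (𝓡 n) (𝓡 n) c.base (p j.pt) := by
  have hb := c.proj_mem _ hj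
  have h1 : ContinuousLinearMap.fst ℝ (Coord n) F ∘L
      tmap 𝓘(ℝ, Coord n × F) 𝓘(ℝ, Coord n × F) c.total j.pt =
      tmap (𝓡 n) (𝓡 n) c.base (p j.pt) ∘L tmap 𝓘(ℝ, Coord n × F) (𝓡 n) p j.pt := by
    rw [← tmap_comp j.pt (mdifferentiableAt_of_mem_maximalAtlas_top c.base_mem hb)
      (hp.mdifferentiable (by simp) _)]
    have h2 : tmap 𝓘(ℝ, Coord n × F) 𝓘(ℝ, Coord n) (Prod.fst : Coord n × F → Coord n)
        (c.total j.pt) = ContinuousLinearMap.fst ℝ (Coord n) F := by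
      change mfderiv _ _ _ _ = _
      rw [mfderiv_eq_fderiv, fderiv_fst]
    rw [← h2, ← tmap_comp j.pt (differentiableAt_fst.mdifferentiableAt)
      (mdifferentiableAt_of_mem_maximalAtlas_top c.total_mem hj)]
    apply tmap_congr
    filter_upwards [c.total.open_source.mem_nhds hj] with e he using c.fst_eq e he
  have h3 := tmap_chart_symm_comp_tmap_chart c.total_mem hj
  have h4 := tmap_chart_symm_comp_tmap_chart c.base_mem hb
  ext1 v
  have h1 := congrArg (fun T : Coord n × F →L[ℝ] Coord n => T (j.lin v)) h1
  have h3 := congrArg (fun T : Coord n × F →L[ℝ] Coord n × F => T (j.lin v)) h3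
  have h4 := congrArg (fun T : Coord n →L[ℝ] Coord n => T v) h4
  have h5 := congrArg (fun T : Coord n →L[ℝ] Coord n => T v) j.proj_lin
  simp only [ContinuousLinearMap.comp_apply, ContinuousLinearMap.id_apply,
    ContinuousLinearMap.coe_fst'] at h1 h3 h4 h5
  rw [h5] at h1
  simp only [jetCoord, ContinuousLinearMap.comp_apply, ContinuousLinearMap.prod_apply,
    ContinuousLinearMap.id_apply, ContinuousLinearMap.coe_snd', h4]
  rw [← h1]
  exact h3.symm

theorem jetCoord_injective (hp : ContMDiff 𝓘(ℝ, Coord n × F) (𝓡 n) ∞ p) :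
    Function.Injective
      fun j : {j : FirstJet n F p // j.pt ∈ c.total.source} => c.jetCoord j := by
  rintro ⟨j, hj⟩ ⟨j', hj'⟩ h
  have h : c.jetCoord j = c.jetCoord j' := h
  have hpt : j.pt = j'.pt := by
    refine c.total.injOn hj hj' (Prod.ext ?_ (congrArg (fun q => q.2.1) h))
    rw [c.fst_eq _ hj, c.fst_eq _ hj']
    exact congrArg Prod.fst h
  exact Subtype.ext (FirstJet.ext hpt (by rw [c.lin_eq hp hj, c.lin_eq hp hj', h, hpt]))

variable [IsManifold 𝓘(ℝ, Coord n × F) ∞ Y]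

/-- The pull-back `(xⁱ, y^α ∘ Φ)` of a fibred coordinate system by a fibred diffeomorphism `Φ` with
inverse `Ψ`. -/
def pull (Φ Ψ : FibredMap n F p) (hl : Function.LeftInverse Ψ.toFun Φ.toFun)
    (hr : Function.RightInverse Ψ.toFun Φ.toFun) : FibredChart n F p where
  base := c.base
  base_mem := c.base_mem
  total := (Homeomorph.mk ⟨Φ.toFun, Ψ.toFun, hl, hr⟩ Φ.smooth.continuous
    Ψ.smooth.continuous).transOpenPartialHomeomorph c.total
  total_mem := OpenPartialHomeomorph.mem_maximalAtlas_of_contMDiffOn _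
    ((contMDiffOn_of_mem_maximalAtlas c.total_mem).comp Φ.smooth.contMDiffOn fun _ h => h)
    (Ψ.smooth.comp_contMDiffOn (contMDiffOn_symm_of_mem_maximalAtlas c.total_mem))
  proj_mem e he := Φ.proj_toFun e ▸ c.proj_mem (Φ.toFun e) he
  fst_eq e he := (c.fst_eq (Φ.toFun e) he).trans (congrArg c.base (Φ.proj_toFun e))

theorem jetCoord_prolong (Φ Ψ : FibredMap n F p)
    (hl : Function.LeftInverse Ψ.toFun Φ.toFun) (hr : Function.RightInverse Ψ.toFun Φ.toFun)
    (hp : ContMDiff 𝓘(ℝ, Coord n × F) (𝓡 n) ∞ p) {j : FirstJet n F p}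
    (hj : Φ.toFun j.pt ∈ c.total.source) :
    c.jetCoord (Φ.prolong hp j) = (c.pull Φ Ψ hl hr).jetCoord j := by
  have h := tmap_comp (f := Φ.toFun) (g := c.total) j.pt
    (mdifferentiableAt_of_mem_maximalAtlas_top c.total_mem hj)
    (Φ.smooth.mdifferentiable (by simp) j.pt)
  have h' : tmap 𝓘(ℝ, Coord n × F) 𝓘(ℝ, Coord n × F) (c.pull Φ Ψ hl hr).total j.pt =
      tmap 𝓘(ℝ, Coord n × F) 𝓘(ℝ, Coord n × F) (fun e => c.total (Φ.toFun e)) j.pt := rfl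
  unfold jetCoord
  rw [h', h]
  change (c.base (p (Φ.toFun j.pt)), (c.total (Φ.toFun j.pt)).2, _ ∘L _ ∘L
    (tmap _ _ Φ.toFun j.pt ∘L j.lin) ∘L tmap _ _ _ (c.base (p (Φ.toFun j.pt)))) = _
  rw [Φ.proj_toFun]
  rfl

/-- An invariant Lagrangian has the same expression in a fibred coordinate system and in its
pull-back: `Φ⁽¹⁾` identifies the points with given coordinates in the two systems. Injectivity of
the jet coordinates is what makes these expressions well defined. -/
theorem localFun_pull (Φ Ψ : FibredMap n F p)
    (hl : Function.LeftInverse Ψ.toFun Φ.toFun) (hr : Function.RightInverse Ψ.toFun Φ.toFun)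
    (hp : ContMDiff 𝓘(ℝ, Coord n × F) (𝓡 n) ∞ p) {L : FirstJet n F p → ℝ}
    (hL : ∀ j, L (Φ.prolong hp j) = L j) :
    (c.pull Φ Ψ hl hr).localFun L = c.localFun L := by
  have hinv : ∀ j, Φ.prolong hp (Ψ.prolong hp j) = j := fun j => by
    refine FirstJet.ext (hr j.pt) ?_
    have h := tmap_comp (f := Ψ.toFun) (g := Φ.toFun) j.pt
      (Φ.smooth.mdifferentiable (by simp) _) (Ψ.smooth.mdifferentiable (by simp) _)
    rw [show (fun e => Φ.toFun (Ψ.toFun e)) = fun e => e from funext hr, tmap_id] at h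
    change tmap _ _ Φ.toFun (Ψ.toFun j.pt) ∘L (tmap _ _ Ψ.toFun j.pt ∘L j.lin) = j.lin
    rw [← ContinuousLinearMap.comp_assoc, ← h, ContinuousLinearMap.id_comp]
  funext q
  -- Both expressions are `0` at values `q` outside the range of the jet coordinates, so the ranges
  -- have to be compared as well.
  by_cases hq : ∃ j : {j : FirstJet n F p // j.pt ∈ (c.pull Φ Ψ hl hr).total.source},
      (c.pull Φ Ψ hl hr).jetCoord j = q
  · obtain ⟨j, rfl⟩ := hq
    have hj : Φ.toFun j.1.pt ∈ c.total.source := j.2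
    have e1 := ((c.pull Φ Ψ hl hr).jetCoord_injective hp).extend_apply (fun j => L j) 0 j
    have e2 := (c.jetCoord_injective hp).extend_apply (fun j => L j) 0 ⟨Φ.prolong hp j, hj⟩
    refine e1.trans ?_
    rw [← c.jetCoord_prolong Φ Ψ hl hr hp hj]
    exact (hL _).symm.trans e2.symm
  · have hq' : ¬∃ j : {j : FirstJet n F p // j.pt ∈ c.total.source}, c.jetCoord j = q := by
      rintro ⟨⟨j, hj⟩, rfl⟩
      have hj' : Φ.toFun (Ψ.prolong hp j).pt ∈ c.total.source := by
        change Φ.toFun (Ψ.toFun j.pt) ∈ _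
        rwa [hr]
      refine hq ⟨⟨Ψ.prolong hp j, hj'⟩, ?_⟩
      rw [← c.jetCoord_prolong Φ Ψ hl hr hp hj', hinv]
    exact (Function.extend_apply' _ _ _ hq).trans (Function.extend_apply' _ _ _ hq').symm

theorem density_pull (Φ Ψ : FibredMap n F p)
    (hl : Function.LeftInverse Ψ.toFun Φ.toFun) (hr : Function.RightInverse Ψ.toFun Φ.toFun)
    (hp : ContMDiff 𝓘(ℝ, Coord n × F) (𝓡 n) ∞ p) (v : VolumeForm n M)
    {L : FirstJet n F p → ℝ} (hL : ∀ j, L (Φ.prolong hp j) = L j) :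
    (c.pull Φ Ψ hl hr).density v L = c.density v L := by
  unfold density
  rw [c.localFun_pull Φ Ψ hl hr hp hL]
  rfl

theorem eqOn_localJetSec_prolong (Φ Ψ : FibredMap n F p)
    (hl : Function.LeftInverse Ψ.toFun Φ.toFun) (hr : Function.RightInverse Ψ.toFun Φ.toFun)
    (hp : ContMDiff 𝓘(ℝ, Coord n × F) (𝓡 n) ∞ p)
    (s : M → FirstJet n F p) :
    Set.EqOn (c.localJetSec (Φ.prolong hp ∘ s)) ((c.pull Φ Ψ hl hr).localJetSec s)
      (c.secDomain fun x => (Φ.prolong hp (s x)).pt) :=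
  fun _ hy => c.jetCoord_prolong Φ Ψ hl hr hp hy.2

end FibredChart

/-! ### Invariance of the solution sets -/

theorem IsSmoothSection.comp_fibredMap (Φ : FibredMap n F p) {s : M → Y}
    (hs : IsSmoothSection (n := n) (F := F) p s) :
    IsSmoothSection (n := n) (F := F) p (Φ.toFun ∘ s) :=
  ⟨fun x => (Φ.proj_toFun (s x)).trans (hs.1 x), Φ.smooth.comp hs.2⟩

variable [IsManifold 𝓘(ℝ, Coord n × F) ∞ Y]

theorem prolong_comp_mem_hamiltonCartanSolutions (Φ Ψ : FibredMap n F p)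
    (hl : Function.LeftInverse Ψ.toFun Φ.toFun) (hr : Function.RightInverse Ψ.toFun Φ.toFun)
    (hp : ContMDiff 𝓘(ℝ, Coord n × F) (𝓡 n) ∞ p)
    (v : VolumeForm n M) {L : FirstJet n F p → ℝ} (hL : ∀ j, L (Φ.prolong hp j) = L j)
    {s : M → FirstJet n F p} (hs : s ∈ hamiltonCartanSolutions v L) :
    Φ.prolong hp ∘ s ∈ hamiltonCartanSolutions v L := by
  obtain ⟨⟨hs1, hs2⟩, hs3⟩ := hs
  have hsec := hs1.comp_fibredMap Φ
  refine ⟨⟨hsec, fun c => ?_⟩, fun c X hX y hy w => ?_⟩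
  · exact (hs2 (c.pull Φ Ψ hl hr)).congr (c.eqOn_localJetSec_prolong Φ Ψ hl hr hp s)
  · -- The domain of the local expression is open, so the two expressions of the section agree
    -- near `y` and have the same derivative there.
    have heq := c.eqOn_localJetSec_prolong Φ Ψ hl hr hp s
    have hev := heq.eventuallyEq_of_mem ((c.isOpen_secDomain hsec.2.continuous).mem_nhds hy)
    have h := hs3 (c.pull Φ Ψ hl hr) X hX y hy w
    rw [c.density_pull Φ Ψ hl hr hp v hL] at h
    rwa [heq hy, hev.fderiv_eq]

theorem comp_mem_eulerLagrangeSolutions (Φ Ψ : FibredMap n F p)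
    (hl : Function.LeftInverse Ψ.toFun Φ.toFun) (hr : Function.RightInverse Ψ.toFun Φ.toFun)
    (hp : ContMDiff 𝓘(ℝ, Coord n × F) (𝓡 n) ∞ p)
    (v : VolumeForm n M) {L : FirstJet n F p → ℝ} (hL : ∀ j, L (Φ.prolong hp j) = L j)
    {s : M → Y} (hs : s ∈ eulerLagrangeSolutions v L) :
    Φ.toFun ∘ s ∈ eulerLagrangeSolutions v L := by
  refine ⟨hs.1.comp_fibredMap Φ, fun c y hy w => ?_⟩
  rw [← c.density_pull Φ Ψ hl hr hp v hL]
  exact hs.2 (c.pull Φ Ψ hl hr) y hy w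

end Naturality

/-! ### The action of the gauge group on connections -/

namespace PrincipalBundle

variable {n m k : ℕ} {M : Type*} [TopologicalSpace M] [ChartedSpace (Coord n) M]
  {G : Type*} [TopologicalSpace G] [ChartedSpace (Coord m) G] [Group G]
  {P : Type*} [TopologicalSpace P] [ChartedSpace (Coord k) P]
  {𝔓 : PrincipalBundle n m k M G P}

variable [LieGroup (𝓡 m) ∞ G] [IsManifold (𝓡 n) ∞ M]

theorem gaugeConn_one (c : 𝔓.Conn) : gaugeConn 1 c = c := by
  refine Conn.ext rfl (funext fun u => ?_)
  change tmap (𝓡 k) (𝓡 k) (fun z : P => z) u ∘L c.lift u = c.lift u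
  rw [tmap_id, ContinuousLinearMap.id_comp]

theorem gaugeConn_mul (Φ Ψ : 𝔓.gauge) (c : 𝔓.Conn) :
    gaugeConn (Φ * Ψ) c = gaugeConn Φ (gaugeConn Ψ c) := by
  refine Conn.ext rfl (funext fun u => ?_)
  change tmap (𝓡 k) (𝓡 k) (fun z => Φ.1 (Ψ.1 z)) (Ψ.1.symm (Φ.1.symm u)) ∘L _ =
    tmap (𝓡 k) (𝓡 k) Φ.1 (Φ.1.symm u) ∘L
      (tmap (𝓡 k) (𝓡 k) Ψ.1 (Ψ.1.symm (Φ.1.symm u)) ∘L c.lift (Ψ.1.symm (Φ.1.symm u)))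
  rw [tmap_comp_of_eq (I' := 𝓡 k) _ (Ψ.1.apply_symm_apply (Φ.1.symm u)) (mdiff_gauge Φ _)
    (mdiff_gauge Ψ _), ContinuousLinearMap.comp_assoc]
  rfl

theorem gaugeJet_one (j : 𝔓.ConnJet) : gaugeJet 1 j = j :=
  FibredMap.prolong_of_forall_eq _ gaugeConn_one j

theorem gaugeJet_mul (Φ Ψ : 𝔓.gauge) (j : 𝔓.ConnJet) :
    gaugeJet (Φ * Ψ) j = gaugeJet Φ (gaugeJet Ψ j) :=
  FibredMap.prolong_of_forall_comp_eq _ (gaugeConn_mul Φ Ψ) j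

theorem leftInverse_gaugeConn_inv (Φ : 𝔓.gauge) :
    Function.LeftInverse (gaugeConn Φ⁻¹) (gaugeConn Φ) := fun c => by
  rw [← gaugeConn_mul, inv_mul_cancel, gaugeConn_one]

theorem rightInverse_gaugeConn_inv (Φ : 𝔓.gauge) :
    Function.RightInverse (gaugeConn Φ⁻¹) (gaugeConn Φ) := fun c => by
  rw [← gaugeConn_mul, mul_inv_cancel, gaugeConn_one]

theorem gaugeJet_comp_mem_hamiltonCartanSolutions {v : VolumeForm n M} {L : 𝔓.ConnJet → ℝ}
    (hinv : IsGaugeInvariant L) (Φ : 𝔓.gauge) {s : M → 𝔓.ConnJet}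
    (hs : s ∈ hamiltonCartanSolutions v L) : gaugeJet Φ ∘ s ∈ hamiltonCartanSolutions v L :=
  prolong_comp_mem_hamiltonCartanSolutions (gaugeMap Φ) (gaugeMap Φ⁻¹)
    (leftInverse_gaugeConn_inv Φ) (rightInverse_gaugeConn_inv Φ) 𝔓.contMDiff_connProj v
    (congrFun (hinv Φ)) hs

theorem gaugeConn_comp_mem_eulerLagrangeSolutions {v : VolumeForm n M} {L : 𝔓.ConnJet → ℝ}
    (hinv : IsGaugeInvariant L) (Φ : 𝔓.gauge) {s : M → 𝔓.Conn}
    (hs : s ∈ eulerLagrangeSolutions v L) : gaugeConn Φ ∘ s ∈ eulerLagrangeSolutions v L :=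
  comp_mem_eulerLagrangeSolutions (gaugeMap Φ) (gaugeMap Φ⁻¹)
    (leftInverse_gaugeConn_inv Φ) (rightInverse_gaugeConn_inv Φ) 𝔓.contMDiff_connProj v
    (congrFun (hinv Φ)) hs

end PrincipalBundle

end

open PrincipalBundle in
theorem propositionL3 {n m k : ℕ}
    {M : Type*} [TopologicalSpace M] [ChartedSpace (Coord n) M] [IsManifold (𝓡 n) ∞ M]
    {G : Type*} [TopologicalSpace G] [ChartedSpace (Coord m) G] [Group G] [LieGroup (𝓡 m) ∞ G]
    {P : Type*} [TopologicalSpace P] [ChartedSpace (Coord k) P] [IsManifold (𝓡 k) ∞ P]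
    (𝔓 : PrincipalBundle n m k M G P) (v : VolumeForm n M)
    (L : 𝔓.ConnJet → ℝ) (hL : IsSmoothLagrangian L) (hinv : IsGaugeInvariant L) :
    (∀ (Φ : 𝔓.gauge), ∀ s ∈ hamiltonCartanSolutions v L,
      gaugeJet Φ ∘ s ∈ hamiltonCartanSolutions v L) ∧
    (∀ (Φ : 𝔓.gauge), ∀ s ∈ eulerLagrangeSolutions v L,
      gaugeConn Φ ∘ s ∈ eulerLagrangeSolutions v L) ∧
    (∃ _ : MulAction 𝔓.gauge (hamiltonCartanSolutions v L),
      ∀ (Φ : 𝔓.gauge) (s : hamiltonCartanSolutions v L),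
        ((Φ • s : hamiltonCartanSolutions v L) : M → 𝔓.ConnJet) = gaugeJet Φ ∘ s.1) ∧
    (∃ _ : MulAction 𝔓.gauge (eulerLagrangeSolutions v L),
      ∀ (Φ : 𝔓.gauge) (s : eulerLagrangeSolutions v L),
        ((Φ • s : eulerLagrangeSolutions v L) : M → 𝔓.Conn) = gaugeConn Φ ∘ s.1) := by

  refine ⟨fun Φ s hs => gaugeJet_comp_mem_hamiltonCartanSolutions hinv Φ hs,
    fun Φ s hs => gaugeConn_comp_mem_eulerLagrangeSolutions hinv Φ hs,
    ⟨{  smul := fun Φ s => ⟨gaugeJet Φ ∘ s.1,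
          gaugeJet_comp_mem_hamiltonCartanSolutions hinv Φ s.2⟩
        one_smul := fun s => Subtype.ext (funext fun x => gaugeJet_one (s.1 x))
        mul_smul := fun Φ Ψ s => Subtype.ext (funext fun x => gaugeJet_mul Φ Ψ (s.1 x)) },
      fun _ _ => rfl⟩,
    ⟨{  smul := fun Φ s => ⟨gaugeConn Φ ∘ s.1,
          gaugeConn_comp_mem_eulerLagrangeSolutions hinv Φ s.2⟩
        one_smul := fun s => Subtype.ext (funext fun x => gaugeConn_one (s.1 x))
        mul_smul := fun Φ Ψ s => Subtype.ext (funext fun x => gaugeConn_mul Φ Ψ (s.1 x)) },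
      fun _ _ => rfl⟩⟩
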